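/- Conventions. Let $\mathcal B$ be a bicategory all of whose 1-morphism categories $\mathcal B(a,b)$ are idempotent complete; write $\otimes$ for composition of 1-morphisms ($Y\otimes X$ is "first $X$, then $Y$") and $I_a$ for units. An adjunction $Y\dashv X$, with $X\in\mathcal B(a,b)$ and $Y\in\mathcal B(b,a)$, consists of 2-morphisms $\varepsilon:Y\otimes X\to I_a$ and $\eta:I_b\to X\otimes Y$ satisfying the two triangle identities; the maps of an adjunction $X\dashv Y$ are denoted $\tilde\varepsilon:X\otimes Y\to I_b$ and $\tilde\eta:I_a\to Y\otimes X$. A Frobenius algebra $A\in\mathcal B(a,a)$ is a unital associative algebra and counital coassociative coalgebra with $(1\otimes\mu)(\Delta\otimes 1)=\Delta\mu=(\mu\otimes 1)(1\otimes\Delta)$; it is separable if $\mu\circ\Delta=1_A$. An isomorphism of Frobenius algebras is a 2-isomorphism compatible with product, unit, coproduct and counit. The equivariant completion $\mathcal B_{\mathrm{eq}}$ is the bicategory whose objects are pairs $(a,A)$ of an object $a\in\mathcal B$ and a separable Frobenius algebra $A\in\mathcal B(a,a)$, whose 1-morphisms $(a,A)\to(b,B)$ are $B$-$A$-bimodules in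 $\mathcal B(a,b)$, whose 2-morphisms are bimodule maps, whose composition is the relative tensor product $Y\otimes_B X$ (the coequaliser of the two $B$-actions, i.e. the image of the canonical idempotent on $Y\otimes X$), whose associator is induced from that of $\mathcal B$, and in which the unit of $(a,A)$ is $A$ with unit isomorphisms given by the actions. A biadjunction $Y\dashv X\dashv Y$ makes $Y\otimes X$ a Frobenius algebra with (suppressing associators and unitors) product $1_Y\otimes\tilde\varepsilon\otimes1_X$, unit $\tilde\eta$, coproduct $1_Y\otimes\eta\otimes1_X$ and counit $\varepsilon$. If $\tilde\varepsilon\circ\eta$ is invertible, put $\varphi=\lambda_X\circ((\tilde\varepsilon\circ\eta)^{-1}\otimes1_X)\circ\lambda_X^{-1}:X\to X$; replacing $\varepsilon,\eta$ by $\varepsilon\circ(1_Y\otimes\varphi^{-1})$ and $(\varphi\otimes1_Y)\circ\eta$ gives another biadjunction, whose associated Frobenius algebra structure on $Y\otimes X$ is separable. Proposition. Let $X\in\mathcal B(a,b)$ and $Y\in\mathcal B(b,a)$. (i) Suppose that $X,Y$ form a biadjunction $Y\dashv X\dashv Y$ such that $\tilde\varepsilon\circ\eta$ is invertible, and let $A=Y\otimes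 X$ with the separable Frobenius algebra structure of the biadjunction twisted by $\varphi$. Then there is an adjoint equivalence $X:(a,A)\rightleftarrows(b,I_b):Y$ in $\mathcal B_{\mathrm{eq}}$, where $A$ acts on $X$ from the right through $\tilde\varepsilon\otimes1_X:X\otimes Y\otimes X\to X$ and on $Y$ from the left through $1_Y\otimes\tilde\varepsilon:Y\otimes X\otimes Y\to Y$, and $I_b$ acts by the unit isomorphisms of $\mathcal B$. (ii) Conversely, let $A\in\mathcal B(a,a)$ be any separable Frobenius algebra and let $X:(a,A)\rightleftarrows(b,I_b):Y$ be an adjoint equivalence in $\mathcal B_{\mathrm{eq}}$, for some bimodule structures on $X$ and $Y$. Then there are adjunctions $Y\dashv X\dashv Y$ in $\mathcal B$ with $\tilde\varepsilon\circ\eta=1_{I_b}$ such that $A$ is isomorphic, as a Frobenius algebra, to $Y\otimes X$ with the Frobenius algebra structure of this biadjunction. -/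

import Mathlib

open CategoryTheory Bicategory

universe w v u

/-!
# The equivariant completion of a bicategory

Composition of 1-morphisms is written in diagrammatic order: for `X : a ⟶ b` and `Y : b ⟶ c`,
the 1-morphism `X ≫ Y : a ⟶ c` is the tensor product `Y ⊗ X`. Accordingly, for a `B`-`A`-bimodule
`X : a ⟶ b`, a right action `X ⊗ A ⟶ X` is a 2-morphism `A ≫ X ⟶ X` and a left
action `B ⊗ X ⟶ X` is a 2-morphism `X ≫ B ⟶ X`.
-/

namespace EquivariantCompletion

variable {B : Type u} [Bicategory.{w, v} B]

/-- A Frobenius algebra structure on an endo-1-morphism `A`: an associative unital product and a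
coassociative counital coproduct that satisfy the Frobenius relations. -/
structure FrobeniusAlgebra {a : B} (A : a ⟶ a) where
  mul : A ≫ A ⟶ A
  one : 𝟙 a ⟶ A
  comul : A ⟶ A ≫ A
  counit : A ⟶ 𝟙 a
  mul_assoc : mul ▷ A ≫ mul = (α_ A A A).hom ≫ A ◁ mul ≫ mul
  one_mul : one ▷ A ≫ mul = (λ_ A).hom
  mul_one : A ◁ one ≫ mul = (ρ_ A).hom
  comul_assoc : comul ≫ comul ▷ A ≫ (α_ A A A).hom = comul ≫ A ◁ comul
  counit_comul : comul ≫ counit ▷ A = (λ_ A).inv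
  comul_counit : comul ≫ A ◁ counit = (ρ_ A).inv
  frob_left : A ◁ comul ≫ (α_ A A A).inv ≫ mul ▷ A = mul ≫ comul
  frob_right : comul ▷ A ≫ (α_ A A A).hom ≫ A ◁ mul = mul ≫ comul

/-- `Δ`-separability: `μ ∘ Δ = 1`. -/
def FrobeniusAlgebra.IsSeparable {a : B} {A : a ⟶ a} (F : FrobeniusAlgebra A) : Prop :=
  F.comul ≫ F.mul = 𝟙 A

/-- An isomorphism of Frobenius algebras: a 2-isomorphism compatible with product, unit, coproduct
and counit. -/
structure FrobeniusAlgebra.Iso {a : B} {A A' : a ⟶ a} (F : FrobeniusAlgebra A)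
    (F' : FrobeniusAlgebra A') where
  iso : A ≅ A'
  map_mul : F.mul ≫ iso.hom = (iso.hom ▷ A ≫ A' ◁ iso.hom) ≫ F'.mul
  map_one : F.one ≫ iso.hom = F'.one
  map_comul : F.comul ≫ (iso.hom ▷ A ≫ A' ◁ iso.hom) = iso.hom ≫ F'.comul
  map_counit : iso.hom ≫ F'.counit = F.counit

/-- The Frobenius algebra structure on `Y ⊗ X` (here `X ≫ Y`) given by a biadjunction
`Y ⊣ X ⊣ Y`. With `ε`, `η` the counit and unit of `l` and `ε'`, `η'` those of `r`, the product is
`1_Y ⊗ ε' ⊗ 1_X`, the unit is `η'`, the coproduct is `1_Y ⊗ η ⊗ 1_X` and the counit is `ε`, where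
associators and unitors are inserted by `⊗≫`. -/
def FrobeniusAlgebra.ofBiadjunction {a b : B} {X : a ⟶ b} {Y : b ⟶ a}
    (l : Y ⊣ X) (r : X ⊣ Y) : FrobeniusAlgebra (X ≫ Y) where
  mul := 𝟙 _ ⊗≫ X ◁ r.counit ▷ Y ⊗≫ 𝟙 _
  one := r.unit
  comul := 𝟙 _ ⊗≫ X ◁ l.unit ▷ Y ⊗≫ 𝟙 _
  counit := l.counit
  mul_assoc := by
    calc _ = 𝟙 _ ⊗≫ X ◁ (r.counit ▷ (Y ≫ X) ≫ 𝟙 b ◁ r.counit) ▷ Y ⊗≫ 𝟙 _ := by bicategory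
      _ = _ := by rw [← whisker_exchange]; bicategory
  one_mul := by
    calc _ = 𝟙 _ ⊗≫ leftZigzag r.unit r.counit ▷ Y ⊗≫ 𝟙 _ := by rw [leftZigzag]; bicategory
      _ = _ := by rw [r.left_triangle]; bicategory
  mul_one := by
    calc _ = 𝟙 _ ⊗≫ X ◁ rightZigzag r.unit r.counit ⊗≫ 𝟙 _ := by rw [rightZigzag]; bicategory
      _ = _ := by rw [r.right_triangle]; bicategory
  comul_assoc := by
    calc _ = 𝟙 _ ⊗≫ X ◁ (𝟙 b ◁ l.unit ≫ l.unit ▷ (Y ≫ X)) ▷ Y ⊗≫ 𝟙 _ := by bicategory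
      _ = _ := by rw [whisker_exchange]; bicategory
  counit_comul := by
    calc _ = 𝟙 _ ⊗≫ rightZigzag l.unit l.counit ▷ Y ⊗≫ 𝟙 _ := by rw [rightZigzag]; bicategory
      _ = _ := by rw [l.right_triangle]; bicategory
  comul_counit := by
    calc _ = 𝟙 _ ⊗≫ X ◁ leftZigzag l.unit l.counit ⊗≫ 𝟙 _ := by rw [leftZigzag]; bicategory
      _ = _ := by rw [l.left_triangle]; bicategory
  frob_left := by
    calc _ = 𝟙 _ ⊗≫ X ◁ ((Y ≫ X) ◁ l.unit ≫ r.counit ▷ (Y ≫ X)) ▷ Y ⊗≫ 𝟙 _ := by bicategory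
      _ = _ := by rw [whisker_exchange]; bicategory
  frob_right := by
    calc _ = 𝟙 _ ⊗≫ X ◁ (l.unit ▷ (Y ≫ X) ≫ (Y ≫ X) ◁ r.counit) ▷ Y ⊗≫ 𝟙 _ := by bicategory
      _ = _ := by rw [← whisker_exchange]; bicategory

/-- The adjunction `Y ⊣ X` twisted by an automorphism `φ` of `X`: its unit is `(φ ⊗ 1_Y) ∘ η` and
its counit is `ε ∘ (1_Y ⊗ φ⁻¹)`. -/
def twist {a b : B} {X : a ⟶ b} {Y : b ⟶ a} (l : Y ⊣ X) (φ : X ≅ X) : Y ⊣ X where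
  unit := l.unit ≫ Y ◁ φ.hom
  counit := φ.inv ▷ Y ≫ l.counit
  left_triangle := by
    calc _ = 𝟙 _ ⊗≫ l.unit ▷ Y ⊗≫ Y ◁ (φ.hom ≫ φ.inv) ▷ Y ⊗≫ Y ◁ l.counit ⊗≫ 𝟙 _ := by
          rw [leftZigzag]; bicategory
      _ = 𝟙 _ ⊗≫ leftZigzag l.unit l.counit ⊗≫ 𝟙 _ := by
          rw [φ.hom_inv_id, leftZigzag]; bicategory
      _ = _ := by rw [l.left_triangle]; bicategory
  right_triangle := by
    calc _ = 𝟙 _ ⊗≫ X ◁ l.unit ⊗≫ ((X ≫ Y) ◁ φ.hom ≫ (φ.inv ▷ Y) ▷ X) ⊗≫ l.counit ▷ X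
              ⊗≫ 𝟙 _ := by
          dsimp only [rightZigzag]; bicategory
      _ = 𝟙 _ ⊗≫ (X ◁ l.unit ≫ φ.inv ▷ (Y ≫ X)) ⊗≫ ((X ≫ Y) ◁ φ.hom ≫ l.counit ▷ X)
              ⊗≫ 𝟙 _ := by
          rw [whisker_exchange]; bicategory
      _ = 𝟙 _ ⊗≫ φ.inv ⊗≫ rightZigzag l.unit l.counit ⊗≫ φ.hom ⊗≫ 𝟙 _ := by
          rw [whisker_exchange, whisker_exchange]; dsimp only [rightZigzag]; bicategory
      _ = 𝟙 _ ⊗≫ (φ.inv ≫ φ.hom) ⊗≫ 𝟙 _ := by rw [l.right_triangle]; bicategory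
      _ = _ := by rw [φ.inv_hom_id]; bicategory

/-- The automorphism `λ_X ∘ ((ε' ∘ η)⁻¹ ⊗ 1_X) ∘ λ_X⁻¹` of `X`, where `η` is the unit of `Y ⊣ X`
and `ε'` is the counit of `X ⊣ Y`. -/
noncomputable def bubbleAut {a b : B} {X : a ⟶ b} {Y : b ⟶ a} (l : Y ⊣ X) (r : X ⊣ Y)
    [IsIso (l.unit ≫ r.counit)] : X ≅ X :=
  (ρ_ X).symm ≪≫ whiskerLeftIso X (asIso (l.unit ≫ r.counit)).symm ≪≫ ρ_ X

theorem bubble_twist {a b : B} {X : a ⟶ b} {Y : b ⟶ a} (l : Y ⊣ X) (r : X ⊣ Y)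
    [IsIso (l.unit ≫ r.counit)] :
    (twist l (bubbleAut l r)).unit ≫ r.counit = 𝟙 (𝟙 b) := by
  calc _ = l.unit ⊗≫ ((Y ≫ X) ◁ inv (l.unit ≫ r.counit) ≫ r.counit ▷ 𝟙 b) ⊗≫ 𝟙 _ := by
        dsimp only [twist, bubbleAut, whiskerLeftIso, Iso.trans, Iso.symm, asIso]; bicategory
    _ = (l.unit ≫ r.counit) ≫ inv (l.unit ≫ r.counit) := by
        rw [whisker_exchange]; bicategory
    _ = _ := IsIso.hom_inv_id _

theorem FrobeniusAlgebra.ofBiadjunction_isSeparable {a b : B} {X : a ⟶ b} {Y : b ⟶ a}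
    (l : Y ⊣ X) (r : X ⊣ Y) (h : l.unit ≫ r.counit = 𝟙 (𝟙 b)) :
    (ofBiadjunction l r).IsSeparable := by
  calc _ = 𝟙 _ ⊗≫ X ◁ (l.unit ≫ r.counit) ▷ Y ⊗≫ 𝟙 _ := by
          dsimp [ofBiadjunction]; bicategory
    _ = _ := by rw [h]; bicategory

/-- The trivial Frobenius algebra structure on the unit 1-morphism. -/
def FrobeniusAlgebra.id (b : B) : FrobeniusAlgebra (𝟙 b) where
  mul := (λ_ (𝟙 b)).hom
  one := 𝟙 _
  comul := (λ_ (𝟙 b)).inv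
  counit := 𝟙 _
  mul_assoc := by bicategory
  one_mul := by bicategory
  mul_one := by bicategory
  comul_assoc := by bicategory
  counit_comul := by bicategory
  comul_counit := by bicategory
  frob_left := by bicategory
  frob_right := by bicategory


/-- Objects of the equivariant completion of `B`: pairs of an object `a` of `B` and a separable
Frobenius algebra `A : a ⟶ a`. -/
structure EqCompletion (B : Type u) [Bicategory.{w, v} B] where
  base : B
  alg : base ⟶ base
  frob : FrobeniusAlgebra alg
  separable : frob.IsSeparable

/-- For objects `P = (a, A)` and `Q = (b, B)`, a `B`-`A`-bimodule `obj : a ⟶ b`. The right action of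
`A` is `src` and the left action of `B` is `tgt`. -/
structure Bimodule (P Q : EqCompletion B) where
  obj : P.base ⟶ Q.base
  src : P.alg ≫ obj ⟶ obj
  tgt : obj ≫ Q.alg ⟶ obj
  src_one : P.frob.one ▷ obj ≫ src = (λ_ obj).hom
  src_mul : P.frob.mul ▷ obj ≫ src = (α_ _ _ _).hom ≫ P.alg ◁ src ≫ src
  tgt_one : obj ◁ Q.frob.one ≫ tgt = (ρ_ obj).hom
  tgt_mul : obj ◁ Q.frob.mul ≫ tgt = (α_ _ _ _).inv ≫ tgt ▷ Q.alg ≫ tgt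
  src_tgt : src ▷ Q.alg ≫ tgt = (α_ _ _ _).hom ≫ P.alg ◁ tgt ≫ src

namespace Bimodule

variable {P Q R S : EqCompletion B}

/-- Bimodule maps. -/
@[ext]
structure Hom (X Y : Bimodule P Q) where
  hom : X.obj ⟶ Y.obj
  src_comm : P.alg ◁ hom ≫ Y.src = X.src ≫ hom
  tgt_comm : hom ▷ Q.alg ≫ Y.tgt = X.tgt ≫ hom

instance : Category (Bimodule P Q) where
  Hom := Hom
  id X := ⟨𝟙 X.obj, by simp, by simp⟩
  comp f g := ⟨f.hom ≫ g.hom,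
    by rw [whiskerLeft_comp, Category.assoc, g.src_comm, ← Category.assoc, f.src_comm,
      Category.assoc],
    by rw [comp_whiskerRight, Category.assoc, g.tgt_comm, ← Category.assoc, f.tgt_comm,
      Category.assoc]⟩
  id_comp _ := Hom.ext (Category.id_comp _)
  comp_id _ := Hom.ext (Category.comp_id _)
  assoc _ _ _ := Hom.ext (Category.assoc _ _ _)

@[ext]
theorem hom_ext {X Y : Bimodule P Q} {f g : X ⟶ Y} (h : f.hom = g.hom) : f = g := Hom.ext h

@[simp] theorem id_hom (X : Bimodule P Q) : Hom.hom (𝟙 X) = 𝟙 X.obj := rfl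
@[simp] theorem comp_hom {X Y Z : Bimodule P Q} (f : X ⟶ Y) (g : Y ⟶ Z) :
    (f ≫ g).hom = f.hom ≫ g.hom := rfl

/-- A 2-isomorphism that is a bimodule map is an isomorphism of bimodules. -/
def isoOf {X Y : Bimodule P Q} (i : X.obj ≅ Y.obj)
    (h : P.alg ◁ i.hom ≫ Y.src = X.src ≫ i.hom)
    (h' : i.hom ▷ Q.alg ≫ Y.tgt = X.tgt ≫ i.hom) : X ≅ Y where
  hom := ⟨i.hom, h, h'⟩
  inv := ⟨i.inv,
    by rw [← cancel_mono i.hom, Category.assoc, Category.assoc, ← h]; simp,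
    by rw [← cancel_mono i.hom, Category.assoc, Category.assoc, ← h']; simp⟩
  hom_inv_id := by ext; simp
  inv_hom_id := by ext; simp

/-- A 2-morphism out of `X ≫ Y` that coequalizes the two actions of the middle algebra. -/
def Balanced (X : Bimodule P Q) (Y : Bimodule Q R) {Z : P.base ⟶ R.base}
    (φ : X.obj ≫ Y.obj ⟶ Z) : Prop :=
  X.tgt ▷ Y.obj ≫ φ = (α_ _ _ _).hom ≫ X.obj ◁ Y.src ≫ φ

/-- The idempotent of `X ≫ Y` whose image is the relative tensor product: insert the coproduct of
the unit of the middle algebra and let its two legs act on `X` and on `Y`. -/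
def proj (X : Bimodule P Q) (Y : Bimodule Q R) : X.obj ≫ Y.obj ⟶ X.obj ≫ Y.obj :=
  𝟙 _ ⊗≫ X.obj ◁ (Q.frob.one ≫ Q.frob.comul) ▷ Y.obj ⊗≫ X.tgt ▷ (Q.alg ≫ Y.obj) ≫
    X.obj ◁ Y.src

section
variable (X : Bimodule P Q) (Y : Bimodule Q R)

/-- A 2-morphism exhibiting the coequalizer of the two actions of the middle algebra as split. -/
def sect : X.obj ≫ Y.obj ⟶ (X.obj ≫ Q.alg) ≫ Y.obj :=
  𝟙 _ ⊗≫ X.obj ◁ (Q.frob.one ≫ Q.frob.comul) ▷ Y.obj ⊗≫ X.tgt ▷ Q.alg ▷ Y.obj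

theorem sect_tgt : sect X Y ≫ X.tgt ▷ Y.obj = 𝟙 _ := by
  calc _ = 𝟙 _ ⊗≫ X.obj ◁ (Q.frob.one ≫ Q.frob.comul) ▷ Y.obj ⊗≫
          ((α_ _ _ _).inv ≫ X.tgt ▷ Q.alg ≫ X.tgt) ▷ Y.obj := by
        rw [sect]; bicategory
    _ = 𝟙 _ ⊗≫ X.obj ◁ (Q.frob.one ≫ (Q.frob.comul ≫ Q.frob.mul)) ▷ Y.obj ⊗≫
          X.tgt ▷ Y.obj := by
        rw [← X.tgt_mul]; bicategory
    _ = 𝟙 _ ⊗≫ (X.obj ◁ Q.frob.one ≫ X.tgt) ▷ Y.obj := by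
        rw [show Q.frob.comul ≫ Q.frob.mul = 𝟙 _ from Q.separable]; bicategory
    _ = _ := by rw [X.tgt_one]; bicategory

theorem sect_src : sect X Y ≫ (α_ _ _ _).hom ≫ X.obj ◁ Y.src = proj X Y := by
  rw [sect, proj]; bicategory

theorem proj_comp {Z : P.base ⟶ R.base} {φ : X.obj ≫ Y.obj ⟶ Z} (h : Balanced X Y φ) :
    proj X Y ≫ φ = φ := by
  rw [← sect_src, Category.assoc, Category.assoc, ← h, ← Category.assoc, sect_tgt,
    Category.id_comp]

theorem whiskerLeft_proj_comp {p : B} {U : p ⟶ P.base} {Z : p ⟶ R.base}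
    {φ : U ≫ X.obj ≫ Y.obj ⟶ Z}
    (h : U ◁ (X.tgt ▷ Y.obj) ≫ φ = U ◁ ((α_ _ _ _).hom ≫ X.obj ◁ Y.src) ≫ φ) :
    U ◁ proj X Y ≫ φ = φ := by
  rw [← sect_src, whiskerLeft_comp, Category.assoc, ← h, ← Category.assoc, ← whiskerLeft_comp,
    sect_tgt, whiskerLeft_id, Category.id_comp]

theorem proj_whiskerRight_comp {p : B} {U : R.base ⟶ p} {Z : P.base ⟶ p}
    {φ : (X.obj ≫ Y.obj) ≫ U ⟶ Z}
    (h : (X.tgt ▷ Y.obj) ▷ U ≫ φ = ((α_ _ _ _).hom ≫ X.obj ◁ Y.src) ▷ U ≫ φ) :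
    proj X Y ▷ U ≫ φ = φ := by
  rw [← sect_src, comp_whiskerRight, Category.assoc, ← h, ← Category.assoc,
    ← comp_whiskerRight, sect_tgt, id_whiskerRight, Category.id_comp]

theorem balanced_proj : Balanced X Y (proj X Y) := by
  have e1 : 𝟙 Q.alg ⊗≫ Q.alg ◁ (Q.frob.one ≫ Q.frob.comul) ⊗≫ Q.frob.mul ▷ Q.alg
      = Q.frob.comul := by
    calc _ = 𝟙 _ ⊗≫ Q.alg ◁ Q.frob.one ⊗≫
          (Q.alg ◁ Q.frob.comul ≫ (α_ _ _ _).inv ≫ Q.frob.mul ▷ Q.alg) := by bicategory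
      _ = 𝟙 _ ⊗≫ (Q.alg ◁ Q.frob.one ≫ Q.frob.mul) ⊗≫ Q.frob.comul := by
        rw [Q.frob.frob_left]; bicategory
      _ = _ := by rw [Q.frob.mul_one]; bicategory
  have e2 : 𝟙 Q.alg ⊗≫ (Q.frob.one ≫ Q.frob.comul) ▷ Q.alg ⊗≫ Q.alg ◁ Q.frob.mul
      = Q.frob.comul := by
    calc _ = 𝟙 _ ⊗≫ Q.frob.one ▷ Q.alg ⊗≫
          (Q.frob.comul ▷ Q.alg ≫ (α_ _ _ _).hom ≫ Q.alg ◁ Q.frob.mul) := by bicategory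
      _ = 𝟙 _ ⊗≫ (Q.frob.one ▷ Q.alg ≫ Q.frob.mul) ⊗≫ Q.frob.comul := by
        rw [Q.frob.frob_right]; bicategory
      _ = _ := by rw [Q.frob.one_mul]; bicategory
  rw [Balanced, proj]
  calc _ = 𝟙 _ ⊗≫ (X.tgt ▷ 𝟙 Q.base ≫ X.obj ◁ (Q.frob.one ≫ Q.frob.comul)) ▷ Y.obj ⊗≫
            X.tgt ▷ (Q.alg ≫ Y.obj) ≫ X.obj ◁ Y.src := by bicategory
    _ = 𝟙 _ ⊗≫ X.obj ◁ Q.alg ◁ (Q.frob.one ≫ Q.frob.comul) ▷ Y.obj ⊗≫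
            ((α_ _ _ _).inv ≫ X.tgt ▷ Q.alg ≫ X.tgt) ▷ (Q.alg ≫ Y.obj) ≫ X.obj ◁ Y.src := by
        rw [← whisker_exchange]; bicategory
    _ = 𝟙 _ ⊗≫ X.obj ◁ (𝟙 Q.alg ⊗≫ Q.alg ◁ (Q.frob.one ≫ Q.frob.comul) ⊗≫ Q.frob.mul ▷ Q.alg)
            ▷ Y.obj ⊗≫ X.tgt ▷ (Q.alg ≫ Y.obj) ≫ X.obj ◁ Y.src := by
        rw [← X.tgt_mul]; bicategory
    _ = 𝟙 _ ⊗≫ X.obj ◁ (𝟙 Q.alg ⊗≫ (Q.frob.one ≫ Q.frob.comul) ▷ Q.alg ⊗≫ Q.alg ◁ Q.frob.mul)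
            ▷ Y.obj ⊗≫ X.tgt ▷ (Q.alg ≫ Y.obj) ≫ X.obj ◁ Y.src := by
        rw [e1, e2]
    _ = 𝟙 _ ⊗≫ X.obj ◁ (Q.frob.one ≫ Q.frob.comul) ▷ (Q.alg ≫ Y.obj) ⊗≫
            ((X.obj ≫ Q.alg) ◁ (Q.frob.mul ▷ Y.obj) ≫ X.tgt ▷ (Q.alg ≫ Y.obj)) ≫
              X.obj ◁ Y.src := by
        bicategory
    _ = 𝟙 _ ⊗≫ X.obj ◁ (Q.frob.one ≫ Q.frob.comul) ▷ (Q.alg ≫ Y.obj) ⊗≫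
            X.tgt ▷ ((Q.alg ≫ Q.alg) ≫ Y.obj) ≫ X.obj ◁ (Q.frob.mul ▷ Y.obj ≫ Y.src) := by
        rw [whisker_exchange]; bicategory
    _ = 𝟙 _ ⊗≫ X.obj ◁ (Q.frob.one ≫ Q.frob.comul) ▷ (Q.alg ≫ Y.obj) ⊗≫
            (X.tgt ▷ (Q.alg ≫ (Q.alg ≫ Y.obj)) ≫ X.obj ◁ (Q.alg ◁ Y.src)) ≫
              X.obj ◁ Y.src := by
        rw [Y.src_mul]; bicategory
    _ = 𝟙 _ ⊗≫ X.obj ◁ ((Q.frob.one ≫ Q.frob.comul) ▷ (Q.alg ≫ Y.obj) ≫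
            (Q.alg ≫ Q.alg) ◁ Y.src) ⊗≫ X.tgt ▷ (Q.alg ≫ Y.obj) ≫ X.obj ◁ Y.src := by
        rw [← whisker_exchange]; bicategory
    _ = _ := by rw [← whisker_exchange]; bicategory

theorem proj_idem : proj X Y ≫ proj X Y = proj X Y := proj_comp X Y (balanced_proj X Y)

end
end Bimodule

instance whiskerLeft_isSplitEpi {a b c : B} (U : a ⟶ b) {f g : b ⟶ c} (φ : f ⟶ g)
    [IsSplitEpi φ] : IsSplitEpi (U ◁ φ) :=
  ⟨⟨U ◁ section_ φ, by rw [← whiskerLeft_comp, IsSplitEpi.id, whiskerLeft_id]⟩⟩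

instance whiskerRight_isSplitEpi {a b c : B} {f g : a ⟶ b} (φ : f ⟶ g) (U : b ⟶ c)
    [IsSplitEpi φ] : IsSplitEpi (φ ▷ U) :=
  ⟨⟨section_ φ ▷ U, by rw [← comp_whiskerRight, IsSplitEpi.id, id_whiskerRight]⟩⟩

namespace Bimodule

variable {P Q R S : EqCompletion B}
variable [∀ a b : B, IsIdempotentComplete (a ⟶ b)]

section
variable (X : Bimodule P Q) (Y : Bimodule Q R)

/-- The idempotent `proj X Y` splits. -/
theorem exists_splitting : ∃ (T : P.base ⟶ R.base) (i : T ⟶ X.obj ≫ Y.obj)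
    (p : X.obj ≫ Y.obj ⟶ T), i ≫ p = 𝟙 T ∧ p ≫ i = proj X Y :=
  IsIdempotentComplete.idempotents_split _ (proj X Y) (proj_idem X Y)

/-- The 1-morphism underlying the tensor product over the middle algebra: a chosen image of the
idempotent `proj X Y`. -/
noncomputable def tensorObj : P.base ⟶ R.base := (exists_splitting X Y).choose

/-- The splitting map into `X ≫ Y`. -/
noncomputable def ι₀ : tensorObj X Y ⟶ X.obj ≫ Y.obj := (exists_splitting X Y).choose_spec.choose

/-- The splitting map out of `X ≫ Y`, which is the coequalizer map. -/
noncomputable def π₀ : X.obj ≫ Y.obj ⟶ tensorObj X Y :=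
  (exists_splitting X Y).choose_spec.choose_spec.choose

theorem ι₀_π₀ : ι₀ X Y ≫ π₀ X Y = 𝟙 _ := (exists_splitting X Y).choose_spec.choose_spec.choose_spec.1

theorem π₀_ι₀ : π₀ X Y ≫ ι₀ X Y = proj X Y :=
  (exists_splitting X Y).choose_spec.choose_spec.choose_spec.2

instance : IsSplitEpi (π₀ X Y) := ⟨⟨ι₀ X Y, ι₀_π₀ X Y⟩⟩

theorem balanced_π₀ : X.tgt ▷ Y.obj ≫ π₀ X Y = (α_ _ _ _).hom ≫ X.obj ◁ Y.src ≫ π₀ X Y := by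
  have h : π₀ X Y = proj X Y ≫ π₀ X Y := by
    rw [← π₀_ι₀, Category.assoc, ι₀_π₀, Category.comp_id]
  have h2 : X.tgt ▷ Y.obj ≫ proj X Y = (α_ _ _ _).hom ≫ X.obj ◁ Y.src ≫ proj X Y :=
    balanced_proj X Y
  rw [h, ← Category.assoc, h2]; simp only [Category.assoc]

theorem π₀_desc {Z : P.base ⟶ R.base} {φ : X.obj ≫ Y.obj ⟶ Z} (h : Balanced X Y φ) :
    π₀ X Y ≫ ι₀ X Y ≫ φ = φ := by
  rw [← Category.assoc, π₀_ι₀, proj_comp X Y h]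

theorem whiskerLeft_π₀_desc {p : B} {U : p ⟶ P.base} {Z : p ⟶ R.base}
    {φ : U ≫ X.obj ≫ Y.obj ⟶ Z}
    (h : U ◁ (X.tgt ▷ Y.obj) ≫ φ = U ◁ ((α_ _ _ _).hom ≫ X.obj ◁ Y.src) ≫ φ) :
    U ◁ π₀ X Y ≫ U ◁ ι₀ X Y ≫ φ = φ := by
  rw [← Category.assoc, ← whiskerLeft_comp, π₀_ι₀, whiskerLeft_proj_comp X Y h]

theorem π₀_desc_whiskerRight {p : B} {U : R.base ⟶ p} {Z : P.base ⟶ p}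
    {φ : (X.obj ≫ Y.obj) ≫ U ⟶ Z}
    (h : (X.tgt ▷ Y.obj) ▷ U ≫ φ = ((α_ _ _ _).hom ≫ X.obj ◁ Y.src) ▷ U ≫ φ) :
    π₀ X Y ▷ U ≫ ι₀ X Y ▷ U ≫ φ = φ := by
  rw [← Category.assoc, ← comp_whiskerRight, π₀_ι₀, proj_whiskerRight_comp X Y h]

/-- The right action on the tensor product, induced by the one on `X`. -/
noncomputable def tensorSrc : P.alg ≫ tensorObj X Y ⟶ tensorObj X Y :=
  P.alg ◁ ι₀ X Y ≫ (α_ _ _ _).inv ≫ X.src ▷ Y.obj ≫ π₀ X Y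

/-- The left action on the tensor product, induced by the one on `Y`. -/
noncomputable def tensorTgt : tensorObj X Y ≫ R.alg ⟶ tensorObj X Y :=
  ι₀ X Y ▷ R.alg ≫ (α_ _ _ _).hom ≫ X.obj ◁ Y.tgt ≫ π₀ X Y

theorem π₀_tensorSrc : P.alg ◁ π₀ X Y ≫ tensorSrc X Y =
    (α_ _ _ _).inv ≫ X.src ▷ Y.obj ≫ π₀ X Y := by
  apply whiskerLeft_π₀_desc
  calc _ = 𝟙 _ ⊗≫ ((α_ _ _ _).hom ≫ P.alg ◁ X.tgt ≫ X.src) ▷ Y.obj ⊗≫ π₀ X Y := by bicategory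
    _ = 𝟙 _ ⊗≫ X.src ▷ Q.alg ▷ Y.obj ⊗≫ (X.tgt ▷ Y.obj ≫ π₀ X Y) := by
      rw [← X.src_tgt]; bicategory
    _ = 𝟙 _ ⊗≫ (X.src ▷ (Q.alg ≫ Y.obj) ≫ X.obj ◁ Y.src) ≫ π₀ X Y := by
      rw [balanced_π₀]; bicategory
    _ = _ := by rw [← whisker_exchange]; bicategory

theorem π₀_tensorTgt : π₀ X Y ▷ R.alg ≫ tensorTgt X Y =
    (α_ _ _ _).hom ≫ X.obj ◁ Y.tgt ≫ π₀ X Y := by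
  apply π₀_desc_whiskerRight
  calc _ = 𝟙 _ ⊗≫ (X.tgt ▷ (Y.obj ≫ R.alg) ≫ X.obj ◁ Y.tgt) ≫ π₀ X Y := by bicategory
    _ = 𝟙 _ ⊗≫ (X.obj ≫ Q.alg) ◁ Y.tgt ≫ (X.tgt ▷ Y.obj ≫ π₀ X Y) := by
      rw [← whisker_exchange]; bicategory
    _ = 𝟙 _ ⊗≫ X.obj ◁ ((α_ _ _ _).hom ≫ Q.alg ◁ Y.tgt ≫ Y.src) ≫ π₀ X Y := by
      rw [balanced_π₀]; bicategory
    _ = _ := by rw [← Y.src_tgt]; bicategory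

/-- The tensor product over the middle algebra, as a bimodule. -/
noncomputable def tensor : Bimodule P R where
  obj := tensorObj X Y
  src := tensorSrc X Y
  tgt := tensorTgt X Y
  src_one := by
    rw [← cancel_epi (𝟙 P.base ◁ π₀ X Y)]
    calc _ = P.frob.one ▷ (X.obj ≫ Y.obj) ≫ (P.alg ◁ π₀ X Y ≫ tensorSrc X Y) := by
          rw [← Category.assoc, whisker_exchange, Category.assoc]
      _ = 𝟙 _ ⊗≫ (P.frob.one ▷ X.obj ≫ X.src) ▷ Y.obj ≫ π₀ X Y := by
          rw [π₀_tensorSrc]; bicategory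
      _ = _ := by rw [X.src_one]; bicategory
  src_mul := by
    rw [← cancel_epi ((P.alg ≫ P.alg) ◁ π₀ X Y)]
    calc _ = P.frob.mul ▷ (X.obj ≫ Y.obj) ≫ (P.alg ◁ π₀ X Y ≫ tensorSrc X Y) := by
          rw [← Category.assoc, whisker_exchange, Category.assoc]
      _ = 𝟙 _ ⊗≫ (P.frob.mul ▷ X.obj ≫ X.src) ▷ Y.obj ≫ π₀ X Y := by
          rw [π₀_tensorSrc]; bicategory
      _ = 𝟙 _ ⊗≫ P.alg ◁ X.src ▷ Y.obj ⊗≫ ((α_ _ _ _).inv ≫ X.src ▷ Y.obj ≫ π₀ X Y) := by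
          rw [X.src_mul]; bicategory
      _ = 𝟙 _ ⊗≫ P.alg ◁ (X.src ▷ Y.obj ≫ π₀ X Y) ⊗≫ tensorSrc X Y := by
          rw [← π₀_tensorSrc]; bicategory
      _ = 𝟙 _ ⊗≫ P.alg ◁ ((α_ _ _ _).inv ≫ X.src ▷ Y.obj ≫ π₀ X Y) ⊗≫ tensorSrc X Y := by
          bicategory
      _ = _ := by rw [← π₀_tensorSrc]; bicategory
  tgt_one := by
    rw [← cancel_epi (π₀ X Y ▷ 𝟙 R.base)]
    calc _ = (X.obj ≫ Y.obj) ◁ R.frob.one ≫ (π₀ X Y ▷ R.alg ≫ tensorTgt X Y) := by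
          rw [← Category.assoc, ← whisker_exchange, Category.assoc]
      _ = 𝟙 _ ⊗≫ X.obj ◁ (Y.obj ◁ R.frob.one ≫ Y.tgt) ≫ π₀ X Y := by
          rw [π₀_tensorTgt]; bicategory
      _ = _ := by rw [Y.tgt_one]; bicategory
  tgt_mul := by
    rw [← cancel_epi (π₀ X Y ▷ (R.alg ≫ R.alg))]
    calc _ = (X.obj ≫ Y.obj) ◁ R.frob.mul ≫ (π₀ X Y ▷ R.alg ≫ tensorTgt X Y) := by
          rw [← Category.assoc, ← whisker_exchange, Category.assoc]
      _ = 𝟙 _ ⊗≫ X.obj ◁ (Y.obj ◁ R.frob.mul ≫ Y.tgt) ≫ π₀ X Y := by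
          rw [π₀_tensorTgt]; bicategory
      _ = 𝟙 _ ⊗≫ X.obj ◁ Y.tgt ▷ R.alg ⊗≫ ((α_ _ _ _).hom ≫ X.obj ◁ Y.tgt ≫ π₀ X Y) := by
          rw [Y.tgt_mul]; bicategory
      _ = 𝟙 _ ⊗≫ (X.obj ◁ Y.tgt ≫ π₀ X Y) ▷ R.alg ⊗≫ tensorTgt X Y := by
          rw [← π₀_tensorTgt]; bicategory
      _ = 𝟙 _ ⊗≫ ((α_ _ _ _).hom ≫ X.obj ◁ Y.tgt ≫ π₀ X Y) ▷ R.alg ⊗≫ tensorTgt X Y := by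
          bicategory
      _ = _ := by rw [← π₀_tensorTgt]; bicategory
  src_tgt := by
    rw [← cancel_epi ((P.alg ◁ π₀ X Y) ▷ R.alg)]
    calc _ = (P.alg ◁ π₀ X Y ≫ tensorSrc X Y) ▷ R.alg ≫ tensorTgt X Y := by
          rw [comp_whiskerRight, Category.assoc]
      _ = 𝟙 _ ⊗≫ X.src ▷ Y.obj ▷ R.alg ≫ (π₀ X Y ▷ R.alg ≫ tensorTgt X Y) := by
          rw [π₀_tensorSrc]; bicategory
      _ = 𝟙 _ ⊗≫ (X.src ▷ (Y.obj ≫ R.alg) ≫ X.obj ◁ Y.tgt) ≫ π₀ X Y := by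
          rw [π₀_tensorTgt]; bicategory
      _ = 𝟙 _ ⊗≫ P.alg ◁ X.obj ◁ Y.tgt ⊗≫ ((α_ _ _ _).inv ≫ X.src ▷ Y.obj ≫ π₀ X Y) := by
          rw [← whisker_exchange]; bicategory
      _ = 𝟙 _ ⊗≫ P.alg ◁ ((α_ _ _ _).hom ≫ X.obj ◁ Y.tgt ≫ π₀ X Y) ⊗≫ tensorSrc X Y := by
          rw [← π₀_tensorSrc]; bicategory
      _ = _ := by rw [← π₀_tensorTgt]; bicategory

end

/-- The unit 1-morphism of `(a, A)` is `A` as a bimodule over itself. -/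
@[reducible] def unit (P : EqCompletion B) : Bimodule P P where
  obj := P.alg
  src := P.frob.mul
  tgt := P.frob.mul
  src_one := P.frob.one_mul
  src_mul := P.frob.mul_assoc
  tgt_one := P.frob.mul_one
  tgt_mul := by rw [P.frob.mul_assoc, Iso.inv_hom_id_assoc]
  src_tgt := P.frob.mul_assoc

section
variable (X : Bimodule P Q) (Y : Bimodule Q R)

/-- The splitting map into `X ≫ Y`. -/
noncomputable def ι : (tensor X Y).obj ⟶ X.obj ≫ Y.obj := ι₀ X Y

/-- The coequalizer map from `X ≫ Y` to the tensor product over the middle algebra. -/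
noncomputable def π : X.obj ≫ Y.obj ⟶ (tensor X Y).obj := π₀ X Y

theorem ι_π : ι X Y ≫ π X Y = 𝟙 _ := ι₀_π₀ X Y

theorem π_ι : π X Y ≫ ι X Y = proj X Y := π₀_ι₀ X Y

instance : IsSplitEpi (π X Y) := ⟨⟨ι X Y, ι_π X Y⟩⟩

theorem balanced_π : X.tgt ▷ Y.obj ≫ π X Y = (α_ _ _ _).hom ≫ X.obj ◁ Y.src ≫ π X Y :=
  balanced_π₀ X Y

theorem π_desc {Z : P.base ⟶ R.base} {φ : X.obj ≫ Y.obj ⟶ Z}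
    (h : X.tgt ▷ Y.obj ≫ φ = (α_ _ _ _).hom ≫ X.obj ◁ Y.src ≫ φ) :
    π X Y ≫ ι X Y ≫ φ = φ := by
  rw [← Category.assoc, π_ι, proj_comp X Y h]

theorem whiskerLeft_π_desc {p : B} {U : p ⟶ P.base} {Z : p ⟶ R.base}
    {φ : U ≫ X.obj ≫ Y.obj ⟶ Z}
    (h : U ◁ (X.tgt ▷ Y.obj) ≫ φ = U ◁ ((α_ _ _ _).hom ≫ X.obj ◁ Y.src) ≫ φ) :
    U ◁ π X Y ≫ U ◁ ι X Y ≫ φ = φ :=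
  whiskerLeft_π₀_desc X Y h

theorem π_desc_whiskerRight {p : B} {U : R.base ⟶ p} {Z : P.base ⟶ p}
    {φ : (X.obj ≫ Y.obj) ≫ U ⟶ Z}
    (h : (X.tgt ▷ Y.obj) ▷ U ≫ φ = ((α_ _ _ _).hom ≫ X.obj ◁ Y.src) ▷ U ≫ φ) :
    π X Y ▷ U ≫ ι X Y ▷ U ≫ φ = φ :=
  π₀_desc_whiskerRight X Y h

theorem π_src : P.alg ◁ π X Y ≫ (tensor X Y).src =
    (α_ _ _ _).inv ≫ X.src ▷ Y.obj ≫ π X Y := π₀_tensorSrc X Y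

theorem π_tgt : π X Y ▷ R.alg ≫ (tensor X Y).tgt =
    (α_ _ _ _).hom ≫ X.obj ◁ Y.tgt ≫ π X Y := π₀_tensorTgt X Y

end

section

/-- The 2-morphism of tensor products over the middle algebra induced by `1_X` and `g`. -/
noncomputable def tensorLeft (X : Bimodule P Q) {Y Y' : Bimodule Q R} (g : Y ⟶ Y') :
    (tensor X Y).obj ⟶ (tensor X Y').obj := ι X Y ≫ X.obj ◁ g.hom ≫ π X Y'

/-- The 2-morphism of tensor products over the middle algebra induced by `f` and `1_Y`. -/
noncomputable def tensorRight {X X' : Bimodule P Q} (f : X ⟶ X') (Y : Bimodule Q R) :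
    (tensor X Y).obj ⟶ (tensor X' Y).obj := ι X Y ≫ f.hom ▷ Y.obj ≫ π X' Y

theorem π_tensorLeft (X : Bimodule P Q) {Y Y' : Bimodule Q R} (g : Y ⟶ Y') :
    π X Y ≫ tensorLeft X g = X.obj ◁ g.hom ≫ π X Y' := by
  apply π_desc
  calc _ = (X.tgt ▷ Y.obj ≫ X.obj ◁ g.hom) ≫ π X Y' := by simp
    _ = (X.obj ≫ Q.alg) ◁ g.hom ≫ (X.tgt ▷ Y'.obj ≫ π X Y') := by
      rw [← whisker_exchange, Category.assoc]
    _ = 𝟙 _ ⊗≫ X.obj ◁ (Q.alg ◁ g.hom ≫ Y'.src) ≫ π X Y' := by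
      rw [balanced_π]; bicategory
    _ = _ := by rw [g.src_comm]; bicategory

theorem π_tensorRight {X X' : Bimodule P Q} (f : X ⟶ X') (Y : Bimodule Q R) :
    π X Y ≫ tensorRight f Y = f.hom ▷ Y.obj ≫ π X' Y := by
  apply π_desc
  calc _ = (X.tgt ≫ f.hom) ▷ Y.obj ≫ π X' Y := by simp
    _ = f.hom ▷ Q.alg ▷ Y.obj ≫ (X'.tgt ▷ Y.obj ≫ π X' Y) := by
      rw [← f.tgt_comm]; bicategory
    _ = 𝟙 _ ⊗≫ (f.hom ▷ (Q.alg ≫ Y.obj) ≫ X'.obj ◁ Y.src) ≫ π X' Y := by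
      rw [balanced_π]; bicategory
    _ = _ := by rw [← whisker_exchange]; bicategory

/-- `tensorLeft` as a bimodule map. -/
noncomputable def whiskerL (X : Bimodule P Q) {Y Y' : Bimodule Q R} (g : Y ⟶ Y') :
    tensor X Y ⟶ tensor X Y' where
  hom := tensorLeft X g
  src_comm := by
    rw [← cancel_epi (P.alg ◁ π X Y)]
    calc _ = P.alg ◁ (π X Y ≫ tensorLeft X g) ≫ (tensor X Y').src := by simp
      _ = P.alg ◁ X.obj ◁ g.hom ≫ (P.alg ◁ π X Y' ≫ (tensor X Y').src) := by
        rw [π_tensorLeft]; simp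
      _ = 𝟙 _ ⊗≫ ((P.alg ≫ X.obj) ◁ g.hom ≫ X.src ▷ Y'.obj) ≫ π X Y' := by
        rw [π_src]; bicategory
      _ = 𝟙 _ ⊗≫ X.src ▷ Y.obj ≫ (X.obj ◁ g.hom ≫ π X Y') := by
        rw [whisker_exchange]; bicategory
      _ = 𝟙 _ ⊗≫ ((α_ _ _ _).inv ≫ X.src ▷ Y.obj ≫ π X Y) ≫ tensorLeft X g := by
        rw [← π_tensorLeft]; bicategory
      _ = _ := by rw [← π_src]; bicategory
  tgt_comm := by
    rw [← cancel_epi (π X Y ▷ R.alg)]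
    calc _ = (π X Y ≫ tensorLeft X g) ▷ R.alg ≫ (tensor X Y').tgt := by simp
      _ = (X.obj ◁ g.hom) ▷ R.alg ≫ (π X Y' ▷ R.alg ≫ (tensor X Y').tgt) := by
        rw [π_tensorLeft]; simp
      _ = 𝟙 _ ⊗≫ X.obj ◁ (g.hom ▷ R.alg ≫ Y'.tgt) ≫ π X Y' := by
        rw [π_tgt]; bicategory
      _ = 𝟙 _ ⊗≫ X.obj ◁ Y.tgt ≫ (X.obj ◁ g.hom ≫ π X Y') := by
        rw [g.tgt_comm]; bicategory
      _ = 𝟙 _ ⊗≫ ((α_ _ _ _).hom ≫ X.obj ◁ Y.tgt ≫ π X Y) ≫ tensorLeft X g := by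
        rw [← π_tensorLeft]; bicategory
      _ = _ := by rw [← π_tgt]; bicategory

/-- `tensorRight` as a bimodule map. -/
noncomputable def whiskerR {X X' : Bimodule P Q} (f : X ⟶ X') (Y : Bimodule Q R) :
    tensor X Y ⟶ tensor X' Y where
  hom := tensorRight f Y
  src_comm := by
    rw [← cancel_epi (P.alg ◁ π X Y)]
    calc _ = P.alg ◁ (π X Y ≫ tensorRight f Y) ≫ (tensor X' Y).src := by simp
      _ = P.alg ◁ f.hom ▷ Y.obj ≫ (P.alg ◁ π X' Y ≫ (tensor X' Y).src) := by
        rw [π_tensorRight]; simp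
      _ = 𝟙 _ ⊗≫ (P.alg ◁ f.hom ≫ X'.src) ▷ Y.obj ≫ π X' Y := by
        rw [π_src]; bicategory
      _ = 𝟙 _ ⊗≫ X.src ▷ Y.obj ≫ (f.hom ▷ Y.obj ≫ π X' Y) := by
        rw [f.src_comm]; bicategory
      _ = 𝟙 _ ⊗≫ ((α_ _ _ _).inv ≫ X.src ▷ Y.obj ≫ π X Y) ≫ tensorRight f Y := by
        rw [← π_tensorRight]; bicategory
      _ = _ := by rw [← π_src]; bicategory
  tgt_comm := by
    rw [← cancel_epi (π X Y ▷ R.alg)]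
    calc _ = (π X Y ≫ tensorRight f Y) ▷ R.alg ≫ (tensor X' Y).tgt := by simp
      _ = (f.hom ▷ Y.obj) ▷ R.alg ≫ (π X' Y ▷ R.alg ≫ (tensor X' Y).tgt) := by
        rw [π_tensorRight]; simp
      _ = 𝟙 _ ⊗≫ (f.hom ▷ (Y.obj ≫ R.alg) ≫ X'.obj ◁ Y.tgt) ≫ π X' Y := by
        rw [π_tgt]; bicategory
      _ = 𝟙 _ ⊗≫ X.obj ◁ Y.tgt ≫ (f.hom ▷ Y.obj ≫ π X' Y) := by
        rw [← whisker_exchange]; bicategory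
      _ = 𝟙 _ ⊗≫ ((α_ _ _ _).hom ≫ X.obj ◁ Y.tgt ≫ π X Y) ≫ tensorRight f Y := by
        rw [← π_tensorRight]; bicategory
      _ = _ := by rw [← π_tgt]; bicategory

end

section
variable (X : Bimodule P Q)

theorem π_unit_left : π (unit P) X ≫ ι (unit P) X ≫ X.src = X.src :=
  π_desc _ _ X.src_mul

theorem π_unit_right : π X (unit Q) ≫ ι X (unit Q) ≫ X.tgt = X.tgt := by
  apply π_desc
  change _ = _ ≫ _ ◁ Q.frob.mul ≫ _
  rw [X.tgt_mul, Iso.hom_inv_id_assoc]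

/-- The 2-isomorphism induced by the action of the source algebra. -/
noncomputable def leftUnitorObj : (tensor (unit P) X).obj ≅ X.obj where
  hom := ι (unit P) X ≫ X.src
  inv := (λ_ X.obj).inv ≫ P.frob.one ▷ X.obj ≫ π (unit P) X
  hom_inv_id := by
    rw [← cancel_epi (π (unit P) X)]
    calc _ = (π (unit P) X ≫ ι (unit P) X ≫ X.src) ≫ (λ_ X.obj).inv ≫ P.frob.one ▷ X.obj ≫
          π (unit P) X := by simp
      _ = 𝟙 _ ⊗≫ (𝟙 P.base ◁ X.src ≫ P.frob.one ▷ X.obj) ≫ π (unit P) X := by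
        rw [π_unit_left]; bicategory
      _ = 𝟙 _ ⊗≫ P.frob.one ▷ (P.alg ≫ X.obj) ⊗≫
          ((α_ _ _ _).hom ≫ (unit P).obj ◁ X.src ≫ π (unit P) X) := by
        rw [whisker_exchange]; dsimp only [unit]; bicategory
      _ = 𝟙 _ ⊗≫ (P.frob.one ▷ P.alg ≫ P.frob.mul) ▷ X.obj ≫ π (unit P) X := by
        rw [← balanced_π]; dsimp only [unit]; bicategory
      _ = _ := by rw [P.frob.one_mul]; dsimp only [unit]; bicategory
  inv_hom_id := by
    calc _ = (λ_ X.obj).inv ≫ P.frob.one ▷ X.obj ≫ (π (unit P) X ≫ ι (unit P) X ≫ X.src) := by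
          simp
      _ = _ := by rw [π_unit_left, X.src_one, Iso.inv_hom_id]

/-- The 2-isomorphism induced by the action of the target algebra. -/
noncomputable def rightUnitorObj : (tensor X (unit Q)).obj ≅ X.obj where
  hom := ι X (unit Q) ≫ X.tgt
  inv := (ρ_ X.obj).inv ≫ X.obj ◁ Q.frob.one ≫ π X (unit Q)
  hom_inv_id := by
    rw [← cancel_epi (π X (unit Q))]
    calc _ = (π X (unit Q) ≫ ι X (unit Q) ≫ X.tgt) ≫ (ρ_ X.obj).inv ≫ X.obj ◁ Q.frob.one ≫
          π X (unit Q) := by simp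
      _ = 𝟙 _ ⊗≫ (X.tgt ▷ 𝟙 Q.base ≫ X.obj ◁ Q.frob.one) ≫ π X (unit Q) := by
        rw [π_unit_right]; bicategory
      _ = 𝟙 _ ⊗≫ (X.obj ≫ Q.alg) ◁ Q.frob.one ⊗≫ (X.tgt ▷ (unit Q).obj ≫ π X (unit Q)) := by
        rw [← whisker_exchange]; dsimp only [unit]; bicategory
      _ = 𝟙 _ ⊗≫ X.obj ◁ (Q.alg ◁ Q.frob.one ≫ Q.frob.mul) ≫ π X (unit Q) := by
        rw [balanced_π]; dsimp only [unit]; bicategory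
      _ = _ := by rw [Q.frob.mul_one]; dsimp only [unit]; bicategory
  inv_hom_id := by
    calc _ = (ρ_ X.obj).inv ≫ X.obj ◁ Q.frob.one ≫ (π X (unit Q) ≫ ι X (unit Q) ≫ X.tgt) := by
          simp
      _ = _ := by rw [π_unit_right, X.tgt_one, Iso.inv_hom_id]

theorem π_leftUnitorObj : π (unit P) X ≫ (leftUnitorObj X).hom = X.src := π_unit_left X
theorem π_rightUnitorObj : π X (unit Q) ≫ (rightUnitorObj X).hom = X.tgt := π_unit_right X

/-- The unit isomorphism given by the action of the source algebra. -/
noncomputable def leftUnit : tensor (unit P) X ≅ X :=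
  isoOf (leftUnitorObj X)
    (by
      rw [← cancel_epi (P.alg ◁ π (unit P) X)]
      calc _ = P.alg ◁ (π (unit P) X ≫ (leftUnitorObj X).hom) ≫ X.src := by simp
        _ = (α_ _ _ _).inv ≫ P.frob.mul ▷ X.obj ≫ X.src := by
          rw [π_leftUnitorObj, X.src_mul]; simp
        _ = ((α_ _ _ _).inv ≫ (unit P).src ▷ X.obj ≫ π (unit P) X) ≫ (leftUnitorObj X).hom := by
          rw [Category.assoc, Category.assoc, π_leftUnitorObj]
        _ = _ := by rw [← π_src, Category.assoc])
    (by
      rw [← cancel_epi (π (unit P) X ▷ Q.alg)]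
      calc _ = (π (unit P) X ≫ (leftUnitorObj X).hom) ▷ Q.alg ≫ X.tgt := by simp
        _ = (α_ _ _ _).hom ≫ P.alg ◁ X.tgt ≫ X.src := by
          rw [π_leftUnitorObj, X.src_tgt]
        _ = ((α_ _ _ _).hom ≫ (unit P).obj ◁ X.tgt ≫ π (unit P) X) ≫ (leftUnitorObj X).hom := by
          rw [Category.assoc, Category.assoc, π_leftUnitorObj]
        _ = _ := by rw [← π_tgt, Category.assoc])

/-- The unit isomorphism given by the action of the target algebra. -/
noncomputable def rightUnit : tensor X (unit Q) ≅ X :=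
  isoOf (rightUnitorObj X)
    (by
      rw [← cancel_epi (P.alg ◁ π X (unit Q))]
      calc _ = P.alg ◁ (π X (unit Q) ≫ (rightUnitorObj X).hom) ≫ X.src := by simp
        _ = (α_ _ _ _).inv ≫ X.src ▷ Q.alg ≫ X.tgt := by
          rw [π_rightUnitorObj, X.src_tgt, Iso.inv_hom_id_assoc]
        _ = ((α_ _ _ _).inv ≫ X.src ▷ (unit Q).obj ≫ π X (unit Q)) ≫ (rightUnitorObj X).hom := by
          rw [Category.assoc, Category.assoc, π_rightUnitorObj]
        _ = _ := by rw [← π_src, Category.assoc])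
    (by
      rw [← cancel_epi (π X (unit Q) ▷ Q.alg)]
      calc _ = (π X (unit Q) ≫ (rightUnitorObj X).hom) ▷ Q.alg ≫ X.tgt := by simp
        _ = (α_ _ _ _).hom ≫ X.obj ◁ Q.frob.mul ≫ X.tgt := by
          rw [π_rightUnitorObj, X.tgt_mul, Iso.hom_inv_id_assoc]
        _ = ((α_ _ _ _).hom ≫ X.obj ◁ (unit Q).tgt ≫ π X (unit Q)) ≫ (rightUnitorObj X).hom := by
          rw [Category.assoc, Category.assoc, π_rightUnitorObj]
        _ = _ := by rw [← π_tgt, Category.assoc])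

end

section
variable (X : Bimodule P Q) (Y : Bimodule Q R) (Z : Bimodule R S)

/-- Auxiliary map for `assocHom`. -/
noncomputable def assocHomAux : (tensor X Y).obj ≫ Z.obj ⟶ (tensor X (tensor Y Z)).obj :=
  ι X Y ▷ Z.obj ≫ (α_ _ _ _).hom ≫ X.obj ◁ π Y Z ≫ π X (tensor Y Z)

theorem π_assocHomAux : π X Y ▷ Z.obj ≫ assocHomAux X Y Z =
    (α_ _ _ _).hom ≫ X.obj ◁ π Y Z ≫ π X (tensor Y Z) := by
  apply π_desc_whiskerRight
  calc _ = 𝟙 _ ⊗≫ (X.tgt ▷ (Y.obj ≫ Z.obj) ≫ X.obj ◁ π Y Z) ≫ π X (tensor Y Z) := by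
        bicategory
    _ = 𝟙 _ ⊗≫ (X.obj ≫ Q.alg) ◁ π Y Z ≫ (X.tgt ▷ (tensor Y Z).obj ≫ π X (tensor Y Z)) := by
        rw [← whisker_exchange]; bicategory
    _ = 𝟙 _ ⊗≫ X.obj ◁ (Q.alg ◁ π Y Z ≫ (tensor Y Z).src) ≫ π X (tensor Y Z) := by
        rw [balanced_π]; bicategory
    _ = _ := by rw [π_src]; bicategory

/-- The 2-morphism induced by the associator of `B`. -/
noncomputable def assocHom : (tensor (tensor X Y) Z).obj ⟶ (tensor X (tensor Y Z)).obj :=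
  ι (tensor X Y) Z ≫ assocHomAux X Y Z

theorem π_assocHom : π (tensor X Y) Z ≫ assocHom X Y Z = assocHomAux X Y Z := by
  apply π_desc
  rw [← cancel_epi (π X Y ▷ R.alg ▷ Z.obj)]
  calc _ = (π X Y ▷ R.alg ≫ (tensor X Y).tgt) ▷ Z.obj ≫ assocHomAux X Y Z := by simp
    _ = 𝟙 _ ⊗≫ X.obj ◁ Y.tgt ▷ Z.obj ⊗≫ (π X Y ▷ Z.obj ≫ assocHomAux X Y Z) := by
      rw [π_tgt]; bicategory
    _ = 𝟙 _ ⊗≫ X.obj ◁ (Y.tgt ▷ Z.obj ≫ π Y Z) ≫ π X (tensor Y Z) := by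
      rw [π_assocHomAux]; bicategory
    _ = 𝟙 _ ⊗≫ (X.obj ≫ Y.obj) ◁ Z.src ⊗≫
          ((α_ _ _ _).hom ≫ X.obj ◁ π Y Z ≫ π X (tensor Y Z)) := by
      rw [balanced_π]; bicategory
    _ = 𝟙 _ ⊗≫ ((X.obj ≫ Y.obj) ◁ Z.src ≫ π X Y ▷ Z.obj) ≫ assocHomAux X Y Z := by
      rw [← π_assocHomAux]; bicategory
    _ = _ := by rw [whisker_exchange]; bicategory

theorem ππ_assocHom : π X Y ▷ Z.obj ≫ π (tensor X Y) Z ≫ assocHom X Y Z =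
    (α_ _ _ _).hom ≫ X.obj ◁ π Y Z ≫ π X (tensor Y Z) := by
  rw [π_assocHom, π_assocHomAux]

/-- Auxiliary map for `assocInv`. -/
noncomputable def assocInvAux : X.obj ≫ (tensor Y Z).obj ⟶ (tensor (tensor X Y) Z).obj :=
  X.obj ◁ ι Y Z ≫ (α_ _ _ _).inv ≫ π X Y ▷ Z.obj ≫ π (tensor X Y) Z

theorem π_assocInvAux : X.obj ◁ π Y Z ≫ assocInvAux X Y Z =
    (α_ _ _ _).inv ≫ π X Y ▷ Z.obj ≫ π (tensor X Y) Z := by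
  apply whiskerLeft_π_desc
  calc _ = 𝟙 _ ⊗≫ ((α_ _ _ _).hom ≫ X.obj ◁ Y.tgt ≫ π X Y) ▷ Z.obj ≫ π (tensor X Y) Z := by
        bicategory
    _ = 𝟙 _ ⊗≫ π X Y ▷ R.alg ▷ Z.obj ≫ ((tensor X Y).tgt ▷ Z.obj ≫ π (tensor X Y) Z) := by
        rw [← π_tgt]; bicategory
    _ = 𝟙 _ ⊗≫ (π X Y ▷ (R.alg ≫ Z.obj) ≫ (tensor X Y).obj ◁ Z.src) ≫ π (tensor X Y) Z := by
        rw [balanced_π]; bicategory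
    _ = _ := by rw [← whisker_exchange]; bicategory

/-- The 2-morphism induced by the inverse associator of `B`. -/
noncomputable def assocInv : (tensor X (tensor Y Z)).obj ⟶ (tensor (tensor X Y) Z).obj :=
  ι X (tensor Y Z) ≫ assocInvAux X Y Z

theorem π_assocInv : π X (tensor Y Z) ≫ assocInv X Y Z = assocInvAux X Y Z := by
  apply π_desc
  rw [← cancel_epi ((X.obj ≫ Q.alg) ◁ π Y Z)]
  calc _ = ((X.obj ≫ Q.alg) ◁ π Y Z ≫ X.tgt ▷ (tensor Y Z).obj) ≫ assocInvAux X Y Z := by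
        rw [Category.assoc]
    _ = X.tgt ▷ (Y.obj ≫ Z.obj) ≫ (X.obj ◁ π Y Z ≫ assocInvAux X Y Z) := by
      rw [whisker_exchange, Category.assoc]
    _ = 𝟙 _ ⊗≫ (X.tgt ▷ Y.obj ≫ π X Y) ▷ Z.obj ≫ π (tensor X Y) Z := by
      rw [π_assocInvAux]; bicategory
    _ = 𝟙 _ ⊗≫ X.obj ◁ Y.src ▷ Z.obj ⊗≫
          ((α_ _ _ _).inv ≫ π X Y ▷ Z.obj ≫ π (tensor X Y) Z) := by
      rw [balanced_π]; bicategory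
    _ = 𝟙 _ ⊗≫ X.obj ◁ ((α_ _ _ _).inv ≫ Y.src ▷ Z.obj ≫ π Y Z) ≫ assocInvAux X Y Z := by
      rw [← π_assocInvAux]; bicategory
    _ = _ := by rw [← π_src]; bicategory

theorem ππ_assocInv : X.obj ◁ π Y Z ≫ π X (tensor Y Z) ≫ assocInv X Y Z =
    (α_ _ _ _).inv ≫ π X Y ▷ Z.obj ≫ π (tensor X Y) Z := by
  rw [π_assocInv, π_assocInvAux]

/-- The 2-isomorphism induced by the associator of `B`. -/
noncomputable def assocObj : (tensor (tensor X Y) Z).obj ≅ (tensor X (tensor Y Z)).obj where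
  hom := assocHom X Y Z
  inv := assocInv X Y Z
  hom_inv_id := by
    rw [← cancel_epi (π (tensor X Y) Z), ← cancel_epi (π X Y ▷ Z.obj)]
    calc _ = (π X Y ▷ Z.obj ≫ π (tensor X Y) Z ≫ assocHom X Y Z) ≫ assocInv X Y Z := by
          simp only [Category.assoc]
      _ = _ := by
          rw [ππ_assocHom, Category.assoc, Category.assoc, ππ_assocInv,
            Iso.hom_inv_id_assoc, Category.comp_id]
  inv_hom_id := by
    rw [← cancel_epi (π X (tensor Y Z)), ← cancel_epi (X.obj ◁ π Y Z)]
    calc _ = (X.obj ◁ π Y Z ≫ π X (tensor Y Z) ≫ assocInv X Y Z) ≫ assocHom X Y Z := by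
          simp only [Category.assoc]
      _ = _ := by
          rw [ππ_assocInv, Category.assoc, Category.assoc, ππ_assocHom,
            Iso.inv_hom_id_assoc, Category.comp_id]

/-- The associator of the relative tensor product, induced by the associator of `B`. -/
noncomputable def assoc : tensor (tensor X Y) Z ≅ tensor X (tensor Y Z) :=
  isoOf (assocObj X Y Z)
    (by
      change P.alg ◁ assocHom X Y Z ≫ (tensor X (tensor Y Z)).src =
        (tensor (tensor X Y) Z).src ≫ assocHom X Y Z
      rw [← cancel_epi (P.alg ◁ π (tensor X Y) Z), ← cancel_epi (P.alg ◁ (π X Y ▷ Z.obj))]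
      calc _ = P.alg ◁ (π X Y ▷ Z.obj ≫ π (tensor X Y) Z ≫ assocHom X Y Z) ≫
                (tensor X (tensor Y Z)).src := by simp
        _ = P.alg ◁ ((α_ _ _ _).hom ≫ X.obj ◁ π Y Z) ≫
              (P.alg ◁ π X (tensor Y Z) ≫ (tensor X (tensor Y Z)).src) := by
            rw [ππ_assocHom]; simp
        _ = 𝟙 _ ⊗≫ ((P.alg ≫ X.obj) ◁ π Y Z ≫ X.src ▷ (tensor Y Z).obj) ≫ π X (tensor Y Z) := by
            rw [π_src]; bicategory
        _ = 𝟙 _ ⊗≫ X.src ▷ Y.obj ▷ Z.obj ⊗≫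
              ((α_ _ _ _).hom ≫ X.obj ◁ π Y Z ≫ π X (tensor Y Z)) := by
            rw [whisker_exchange]; bicategory
        _ = 𝟙 _ ⊗≫ ((α_ _ _ _).inv ≫ X.src ▷ Y.obj ≫ π X Y) ▷ Z.obj ≫
              π (tensor X Y) Z ≫ assocHom X Y Z := by
            rw [← ππ_assocHom]; bicategory
        _ = 𝟙 _ ⊗≫ P.alg ◁ π X Y ▷ Z.obj ⊗≫
              ((α_ _ _ _).inv ≫ (tensor X Y).src ▷ Z.obj ≫ π (tensor X Y) Z) ≫
                assocHom X Y Z := by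
            rw [← π_src]; bicategory
        _ = _ := by
            rw [← π_src]; bicategory)
    (by
      change assocHom X Y Z ▷ S.alg ≫ (tensor X (tensor Y Z)).tgt =
        (tensor (tensor X Y) Z).tgt ≫ assocHom X Y Z
      rw [← cancel_epi (π (tensor X Y) Z ▷ S.alg), ← cancel_epi (π X Y ▷ Z.obj ▷ S.alg)]
      calc _ = (π X Y ▷ Z.obj ≫ π (tensor X Y) Z ≫ assocHom X Y Z) ▷ S.alg ≫
                (tensor X (tensor Y Z)).tgt := by simp
        _ = ((α_ _ _ _).hom ≫ X.obj ◁ π Y Z) ▷ S.alg ≫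
              (π X (tensor Y Z) ▷ S.alg ≫ (tensor X (tensor Y Z)).tgt) := by
            rw [ππ_assocHom]; simp
        _ = 𝟙 _ ⊗≫ X.obj ◁ (π Y Z ▷ S.alg ≫ (tensor Y Z).tgt) ≫ π X (tensor Y Z) := by
            rw [π_tgt]; bicategory
        _ = 𝟙 _ ⊗≫ (X.obj ≫ Y.obj) ◁ Z.tgt ≫
              ((α_ _ _ _).hom ≫ X.obj ◁ π Y Z ≫ π X (tensor Y Z)) := by
            rw [π_tgt]; bicategory
        _ = 𝟙 _ ⊗≫ ((X.obj ≫ Y.obj) ◁ Z.tgt ≫ π X Y ▷ Z.obj) ≫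
              π (tensor X Y) Z ≫ assocHom X Y Z := by
            rw [← ππ_assocHom]; bicategory
        _ = 𝟙 _ ⊗≫ π X Y ▷ Z.obj ▷ S.alg ⊗≫
              ((α_ _ _ _).hom ≫ (tensor X Y).obj ◁ Z.tgt ≫ π (tensor X Y) Z) ≫
                assocHom X Y Z := by
            rw [whisker_exchange]; bicategory
        _ = _ := by
            rw [← π_tgt]; bicategory)

end

theorem tensor_hom_ext {X : Bimodule P Q} {Y : Bimodule Q R} {T : Bimodule P R}
    {f g : tensor X Y ⟶ T} (h : π X Y ≫ f.hom = π X Y ≫ g.hom) : f = g :=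
  hom_ext ((cancel_epi _).1 h)

end Bimodule

namespace Bimodule

variable {P Q R S : EqCompletion B}
variable [∀ a b : B, IsIdempotentComplete (a ⟶ b)]

theorem π_whiskerL (X : Bimodule P Q) {Y Y' : Bimodule Q R} (g : Y ⟶ Y') :
    π X Y ≫ (whiskerL X g).hom = X.obj ◁ g.hom ≫ π X Y' := π_tensorLeft X g

theorem π_whiskerR {X X' : Bimodule P Q} (f : X ⟶ X') (Y : Bimodule Q R) :
    π X Y ≫ (whiskerR f Y).hom = f.hom ▷ Y.obj ≫ π X' Y := π_tensorRight f Y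

theorem π_leftUnit (X : Bimodule P Q) : π (unit P) X ≫ (leftUnit X).hom.hom = X.src :=
  π_leftUnitorObj X

theorem π_rightUnit (X : Bimodule P Q) : π X (unit Q) ≫ (rightUnit X).hom.hom = X.tgt :=
  π_rightUnitorObj X

theorem π_assoc (X : Bimodule P Q) (Y : Bimodule Q R) (Z : Bimodule R S) :
    π X Y ▷ Z.obj ≫ π (tensor X Y) Z ≫ (assoc X Y Z).hom.hom =
    (α_ _ _ _).hom ≫ X.obj ◁ π Y Z ≫ π X (tensor Y Z) := ππ_assocHom X Y Z

theorem tensor₃_hom_ext {X : Bimodule P Q} {Y : Bimodule Q R} {Z : Bimodule R S}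
    {T : Bimodule P S} {f g : tensor (tensor X Y) Z ⟶ T}
    (h : π X Y ▷ Z.obj ≫ π (tensor X Y) Z ≫ f.hom = π X Y ▷ Z.obj ≫ π (tensor X Y) Z ≫ g.hom) :
    f = g :=
  tensor_hom_ext ((cancel_epi _).1 h)

end Bimodule

open Bimodule

variable [∀ a b : B, IsIdempotentComplete (a ⟶ b)]

/-- The equivariant completion: 1-morphisms are bimodules, 2-morphisms are bimodule maps, composition
is the tensor product over the middle algebra, and the unit 1-morphism of `(a, A)` is `A`. -/
noncomputable instance : Bicategory.{w, max w v} (EqCompletion B) where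
  Hom P Q := Bimodule P Q
  id P := unit P
  comp X Y := tensor X Y
  homCategory P Q := inferInstanceAs (Category (Bimodule P Q))
  whiskerLeft X _ _ g := whiskerL X g
  whiskerRight f Y := whiskerR f Y
  associator X Y Z := assoc X Y Z
  leftUnitor X := leftUnit X
  rightUnitor X := rightUnit X
  whiskerLeft_id X Y := tensor_hom_ext (by
    rw [π_whiskerL]; simp)
  whiskerLeft_comp X _ _ _ f g := tensor_hom_ext (by
    rw [π_whiskerL, comp_hom, comp_hom, ← Category.assoc, π_whiskerL, Category.assoc, π_whiskerL]
    simp)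
  id_whiskerRight X Y := tensor_hom_ext (by
    rw [π_whiskerR]; simp)
  comp_whiskerRight f g Y := tensor_hom_ext (by
    rw [π_whiskerR, comp_hom, comp_hom, ← Category.assoc, π_whiskerR, Category.assoc, π_whiskerR]
    simp)
  id_whiskerLeft {P Q X Y} f := by
    rw [← Category.assoc, Iso.eq_comp_inv]
    apply tensor_hom_ext
    rw [comp_hom, comp_hom, ← Category.assoc, π_whiskerL, Category.assoc, π_leftUnit,
      ← Category.assoc, π_leftUnit, ← f.src_comm]
  whiskerRight_id {P Q X Y} f := by
    rw [← Category.assoc, Iso.eq_comp_inv]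
    apply tensor_hom_ext
    rw [comp_hom, comp_hom, ← Category.assoc, π_whiskerR, Category.assoc, π_rightUnit,
      ← Category.assoc, π_rightUnit, ← f.tgt_comm]
  comp_whiskerLeft {P Q R S} X Y Z Z' f := by
    rw [← Category.assoc, Iso.eq_comp_inv]
    apply tensor₃_hom_ext
    calc _ = π X Y ▷ Z.obj ≫ (π (tensor X Y) Z ≫ (whiskerL (tensor X Y) f).hom) ≫
            (assoc X Y Z').hom.hom := by simp only [comp_hom, Category.assoc]
      _ = (π X Y ▷ Z.obj ≫ (tensor X Y).obj ◁ f.hom) ≫ π (tensor X Y) Z' ≫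
            (assoc X Y Z').hom.hom := by rw [π_whiskerL]; simp only [Category.assoc]
      _ = (X.obj ≫ Y.obj) ◁ f.hom ≫ (α_ _ _ _).hom ≫ X.obj ◁ π Y Z' ≫ π X (tensor Y Z') := by
          rw [← whisker_exchange, Category.assoc, π_assoc]
      _ = (α_ _ _ _).hom ≫ X.obj ◁ (Y.obj ◁ f.hom ≫ π Y Z') ≫ π X (tensor Y Z') := by simp
      _ = ((α_ _ _ _).hom ≫ X.obj ◁ π Y Z ≫ (X.obj ◁ (whiskerL Y f).hom ≫ π X (tensor Y Z'))) := by
          rw [← π_whiskerL]; simp only [Bicategory.whiskerLeft_comp, Category.assoc]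
      _ = ((α_ _ _ _).hom ≫ X.obj ◁ π Y Z ≫ π X (tensor Y Z)) ≫ (whiskerL X (whiskerL Y f)).hom := by
          rw [← π_whiskerL]; simp only [Category.assoc]
      _ = _ := by rw [← π_assoc]; simp only [comp_hom, Category.assoc]
  whiskerRight_comp {P Q R S X X'} f Y Z := by
    rw [Iso.eq_inv_comp]
    apply tensor₃_hom_ext
    calc _ = (π X Y ▷ Z.obj ≫ π (tensor X Y) Z ≫ (assoc X Y Z).hom.hom) ≫
            (whiskerR f (tensor Y Z)).hom := by simp only [comp_hom, Category.assoc]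
      _ = (α_ _ _ _).hom ≫ X.obj ◁ π Y Z ≫ (π X (tensor Y Z) ≫ (whiskerR f (tensor Y Z)).hom) := by
          rw [π_assoc]; simp only [Category.assoc]
      _ = (α_ _ _ _).hom ≫ (X.obj ◁ π Y Z ≫ f.hom ▷ (tensor Y Z).obj) ≫ π X' (tensor Y Z) := by
          rw [π_whiskerR]; simp only [Category.assoc]
      _ = f.hom ▷ Y.obj ▷ Z.obj ≫ ((α_ _ _ _).hom ≫ X'.obj ◁ π Y Z ≫ π X' (tensor Y Z)) := by
          rw [whisker_exchange]; simp
      _ = (f.hom ▷ Y.obj ≫ π X' Y) ▷ Z.obj ≫ π (tensor X' Y) Z ≫ (assoc X' Y Z).hom.hom := by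
          rw [← π_assoc]; simp
      _ = π X Y ▷ Z.obj ≫ ((whiskerR f Y).hom ▷ Z.obj ≫ π (tensor X' Y) Z) ≫
            (assoc X' Y Z).hom.hom := by
          rw [← π_whiskerR]; simp only [Bicategory.comp_whiskerRight, Category.assoc]
      _ = _ := by rw [← π_whiskerR]; simp only [comp_hom, Category.assoc]
  whisker_assoc {P Q R S} X Y Y' f Z := by
    rw [← Category.assoc, Iso.eq_comp_inv]
    apply tensor₃_hom_ext
    calc _ = π X Y ▷ Z.obj ≫ (π (tensor X Y) Z ≫ (whiskerR (whiskerL X f) Z).hom) ≫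
            (assoc X Y' Z).hom.hom := by simp only [comp_hom, Category.assoc]
      _ = (π X Y ≫ (whiskerL X f).hom) ▷ Z.obj ≫ π (tensor X Y') Z ≫
            (assoc X Y' Z).hom.hom := by
          rw [π_whiskerR]; simp only [Bicategory.comp_whiskerRight, Category.assoc]
      _ = (X.obj ◁ f.hom) ▷ Z.obj ≫ (π X Y' ▷ Z.obj ≫ π (tensor X Y') Z ≫
            (assoc X Y' Z).hom.hom) := by
          rw [π_whiskerL]; simp only [Bicategory.comp_whiskerRight, Category.assoc]
      _ = (α_ _ _ _).hom ≫ X.obj ◁ (f.hom ▷ Z.obj ≫ π Y' Z) ≫ π X (tensor Y' Z) := by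
          rw [π_assoc]; simp
      _ = (α_ _ _ _).hom ≫ X.obj ◁ π Y Z ≫ (X.obj ◁ (whiskerR f Z).hom ≫ π X (tensor Y' Z)) := by
          rw [← π_whiskerR]; simp only [Bicategory.whiskerLeft_comp, Category.assoc]
      _ = ((α_ _ _ _).hom ≫ X.obj ◁ π Y Z ≫ π X (tensor Y Z)) ≫ (whiskerL X (whiskerR f Z)).hom := by
          rw [← π_whiskerL]; simp only [Category.assoc]
      _ = _ := by rw [← π_assoc]; simp only [comp_hom, Category.assoc]
  whisker_exchange {P Q R X X' Y Y'} f g := by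
    apply tensor_hom_ext
    calc _ = (π X Y ≫ (whiskerL X g).hom) ≫ (whiskerR f Y').hom := by
          simp only [comp_hom, Category.assoc]
      _ = (X.obj ◁ g.hom ≫ f.hom ▷ Y'.obj) ≫ π X' Y' := by
          rw [π_whiskerL, Category.assoc, π_whiskerR, Category.assoc]
      _ = (π X Y ≫ (whiskerR f Y).hom) ≫ (whiskerL X' g).hom := by
          rw [whisker_exchange, π_whiskerR, Category.assoc, Category.assoc, π_whiskerL]
      _ = _ := by simp only [comp_hom, Category.assoc]
  pentagon {P Q R S T} X Y Z U := by
    apply tensor_hom_ext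
    rw [← cancel_epi (π (tensor X Y) Z ▷ U.obj), ← cancel_epi (π X Y ▷ Z.obj ▷ U.obj)]
    calc _ = π X Y ▷ Z.obj ▷ U.obj ≫ π (tensor X Y) Z ▷ U.obj ≫
            (π (tensor (tensor X Y) Z) U ≫ (whiskerR (assoc X Y Z).hom U).hom) ≫
            (assoc X (tensor Y Z) U).hom.hom ≫ (whiskerL X (assoc Y Z U).hom).hom := by
          simp only [comp_hom, Category.assoc]
      _ = (π X Y ▷ Z.obj ≫ π (tensor X Y) Z ≫ (assoc X Y Z).hom.hom) ▷ U.obj ≫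
            π (tensor X (tensor Y Z)) U ≫
            (assoc X (tensor Y Z) U).hom.hom ≫ (whiskerL X (assoc Y Z U).hom).hom := by
          rw [π_whiskerR]; simp only [Bicategory.comp_whiskerRight, Category.assoc]
      _ = (α_ _ _ _).hom ▷ U.obj ≫ (X.obj ◁ π Y Z) ▷ U.obj ≫ (π X (tensor Y Z) ▷ U.obj ≫
            π (tensor X (tensor Y Z)) U ≫
            (assoc X (tensor Y Z) U).hom.hom) ≫ (whiskerL X (assoc Y Z U).hom).hom := by
          rw [π_assoc]; simp only [Bicategory.comp_whiskerRight, Category.assoc]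
      _ = (α_ _ _ _).hom ▷ U.obj ≫ (X.obj ◁ π Y Z) ▷ U.obj ≫ (α_ _ _ _).hom ≫
            X.obj ◁ π (tensor Y Z) U ≫
            (π X (tensor (tensor Y Z) U) ≫ (whiskerL X (assoc Y Z U).hom).hom) := by
          rw [π_assoc]; simp only [Category.assoc]
      _ = (α_ _ _ _).hom ▷ U.obj ≫ (α_ _ _ _).hom ≫ X.obj ◁ (π Y Z ▷ U.obj ≫
            π (tensor Y Z) U ≫ (assoc Y Z U).hom.hom) ≫ π X (tensor Y (tensor Z U)) := by
          rw [π_whiskerL]; simp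
      _ = (α_ _ _ _).hom ≫ (α_ _ _ _).hom ≫ X.obj ◁ (Y.obj ◁ π Z U ≫ π Y (tensor Z U)) ≫
            π X (tensor Y (tensor Z U)) := by
          rw [π_assoc]; simp
      _ = (α_ _ _ _).hom ≫ (X.obj ≫ Y.obj) ◁ π Z U ≫
            ((α_ _ _ _).hom ≫ X.obj ◁ π Y (tensor Z U) ≫ π X (tensor Y (tensor Z U))) := by
          simp
      _ = (α_ _ _ _).hom ≫ ((X.obj ≫ Y.obj) ◁ π Z U ≫ π X Y ▷ (tensor Z U).obj) ≫
            π (tensor X Y) (tensor Z U) ≫ (assoc X Y (tensor Z U)).hom.hom := by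
          rw [← π_assoc]; simp only [Category.assoc]
      _ = π X Y ▷ Z.obj ▷ U.obj ≫ ((α_ _ _ _).hom ≫ (tensor X Y).obj ◁ π Z U ≫
            π (tensor X Y) (tensor Z U)) ≫ (assoc X Y (tensor Z U)).hom.hom := by
          rw [whisker_exchange]; simp
      _ = _ := by rw [← π_assoc]; simp only [comp_hom, Category.assoc]
  triangle {P Q R} X Y := by
    apply tensor₃_hom_ext
    calc _ = (π X (unit Q) ▷ Y.obj ≫ π (tensor X (unit Q)) Y ≫ (assoc X (unit Q) Y).hom.hom) ≫
            (whiskerL X (leftUnit Y).hom).hom := by simp only [comp_hom, Category.assoc]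
      _ = (α_ _ _ _).hom ≫ X.obj ◁ π (unit Q) Y ≫ (π X (tensor (unit Q) Y) ≫
            (whiskerL X (leftUnit Y).hom).hom) := by
          rw [π_assoc]; simp only [Category.assoc]
      _ = (α_ _ _ _).hom ≫ X.obj ◁ (π (unit Q) Y ≫ (leftUnit Y).hom.hom) ≫ π X Y := by
          rw [π_whiskerL]; simp only [Bicategory.whiskerLeft_comp, Category.assoc]
      _ = X.tgt ▷ Y.obj ≫ π X Y := by
          rw [π_leftUnit, balanced_π]
      _ = π X (unit Q) ▷ Y.obj ≫ ((rightUnit X).hom.hom ▷ Y.obj ≫ π X Y) := by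
          rw [← π_rightUnit, Bicategory.comp_whiskerRight, Category.assoc]
      _ = _ := by rw [← π_whiskerR]

/-- The object `(b, I_b)` of the equivariant completion. -/
def EqCompletion.ofBase (b : B) : EqCompletion B where
  base := b
  alg := 𝟙 b
  frob := FrobeniusAlgebra.id b
  separable := by simp [FrobeniusAlgebra.id, FrobeniusAlgebra.IsSeparable]

section

variable {a b : B} {X : a ⟶ b} {Y : b ⟶ a} (l : Y ⊣ X) (r : X ⊣ Y) [IsIso (l.unit ≫ r.counit)]

/-- For a biadjunction `Y ⊣ X ⊣ Y` such that the unit of `Y ⊣ X` followed by the counit of `X ⊣ Y`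
is invertible: the object `(a, A)` of the equivariant completion, where `A = Y ⊗ X` carries the
separable Frobenius algebra structure of the biadjunction in which `Y ⊣ X` is twisted by
`bubbleAut`. -/
noncomputable def EqCompletion.ofBiadjunction : EqCompletion B where
  base := a
  alg := X ≫ Y
  frob := FrobeniusAlgebra.ofBiadjunction (twist l (bubbleAut l r)) r
  separable := FrobeniusAlgebra.ofBiadjunction_isSeparable _ _ (bubble_twist l r)

/-- `X` as a 1-morphism `(a, Y ⊗ X) ⟶ (b, I_b)`: the right action of `Y ⊗ X` is given by the counit
of `X ⊣ Y`. -/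
noncomputable def Bimodule.ofRight :
    Bimodule (EqCompletion.ofBiadjunction l r) (EqCompletion.ofBase b) where
  obj := X
  src := (α_ X Y X).hom ≫ X ◁ r.counit ≫ (ρ_ X).hom
  tgt := (ρ_ X).hom
  src_one := by
    change r.unit ▷ X ≫ (α_ X Y X).hom ≫ X ◁ r.counit ≫ (ρ_ X).hom = _
    calc _ = leftZigzag r.unit r.counit ≫ (ρ_ X).hom := by dsimp only [leftZigzag]; bicategory
      _ = _ := by rw [r.left_triangle]; simp; rfl
  src_mul := by
    change (𝟙 _ ⊗≫ X ◁ r.counit ▷ Y ⊗≫ 𝟙 _) ▷ X ≫ (α_ X Y X).hom ≫ X ◁ r.counit ≫ (ρ_ X).hom =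
      (α_ (X ≫ Y) (X ≫ Y) X).hom ≫ (X ≫ Y) ◁ ((α_ X Y X).hom ≫ X ◁ r.counit ≫ (ρ_ X).hom) ≫
        (α_ X Y X).hom ≫ X ◁ r.counit ≫ (ρ_ X).hom
    calc _ = 𝟙 _ ⊗≫ X ◁ (r.counit ▷ (Y ≫ X) ≫ 𝟙 b ◁ r.counit) ⊗≫ 𝟙 _ := by bicategory
      _ = _ := by rw [← whisker_exchange]; bicategory
  tgt_one := by
    change X ◁ 𝟙 (𝟙 b) ≫ (ρ_ X).hom = _
    simp; rfl
  tgt_mul := by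
    change X ◁ (λ_ (𝟙 b)).hom ≫ (ρ_ X).hom =
      (α_ X (𝟙 b) (𝟙 b)).inv ≫ (ρ_ X).hom ▷ 𝟙 b ≫ (ρ_ X).hom
    bicategory
  src_tgt := by
    change ((α_ X Y X).hom ≫ X ◁ r.counit ≫ (ρ_ X).hom) ▷ 𝟙 b ≫ (ρ_ X).hom =
      (α_ (X ≫ Y) X (𝟙 b)).hom ≫ (X ≫ Y) ◁ (ρ_ X).hom ≫
        (α_ X Y X).hom ≫ X ◁ r.counit ≫ (ρ_ X).hom
    bicategory

/-- `Y` as a 1-morphism `(b, I_b) ⟶ (a, Y ⊗ X)`: the left action of `Y ⊗ X` is given by the counit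
of `X ⊣ Y`. -/
noncomputable def Bimodule.ofLeft :
    Bimodule (EqCompletion.ofBase b) (EqCompletion.ofBiadjunction l r) where
  obj := Y
  src := (λ_ Y).hom
  tgt := (α_ Y X Y).inv ≫ r.counit ▷ Y ≫ (λ_ Y).hom
  src_one := by
    change 𝟙 (𝟙 b) ▷ Y ≫ (λ_ Y).hom = _
    simp; rfl
  src_mul := by
    change (λ_ (𝟙 b)).hom ▷ Y ≫ (λ_ Y).hom =
      (α_ (𝟙 b) (𝟙 b) Y).hom ≫ 𝟙 b ◁ (λ_ Y).hom ≫ (λ_ Y).hom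
    bicategory
  tgt_one := by
    change Y ◁ r.unit ≫ (α_ Y X Y).inv ≫ r.counit ▷ Y ≫ (λ_ Y).hom = _
    calc _ = rightZigzag r.unit r.counit ≫ (λ_ Y).hom := by dsimp only [rightZigzag]; bicategory
      _ = _ := by rw [r.right_triangle]; simp; rfl
  tgt_mul := by
    change Y ◁ (𝟙 _ ⊗≫ X ◁ r.counit ▷ Y ⊗≫ 𝟙 _) ≫ (α_ Y X Y).inv ≫ r.counit ▷ Y ≫ (λ_ Y).hom =
      (α_ Y (X ≫ Y) (X ≫ Y)).inv ≫ ((α_ Y X Y).inv ≫ r.counit ▷ Y ≫ (λ_ Y).hom) ▷ (X ≫ Y) ≫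
        (α_ Y X Y).inv ≫ r.counit ▷ Y ≫ (λ_ Y).hom
    calc _ = 𝟙 _ ⊗≫ ((Y ≫ X) ◁ r.counit ≫ r.counit ▷ 𝟙 b) ▷ Y ⊗≫ 𝟙 _ := by bicategory
      _ = _ := by rw [whisker_exchange]; bicategory
  src_tgt := by
    change (λ_ Y).hom ▷ (X ≫ Y) ≫ (α_ Y X Y).inv ≫ r.counit ▷ Y ≫ (λ_ Y).hom =
      (α_ (𝟙 b) Y (X ≫ Y)).hom ≫ 𝟙 b ◁ ((α_ Y X Y).inv ≫ r.counit ▷ Y ≫ (λ_ Y).hom) ≫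
        (λ_ Y).hom
    bicategory

end

end EquivariantCompletion

open EquivariantCompletion

/-!
Part (i). The algebra of `(b, I_b)` is trivial, so the tensor product over it is the composite in
`B` (`Bimodule.πIso`), and `Y ⊗ X` as a bimodule over itself is the composite of the bimodules `X`
and `Y` (`unitIso`). In the other order, the coproduct of `A = Y ⊗ X` is made from the unit `s` of
the twisted adjunction `Y ⊣ X`, and a triangle identity of `X ⊣ Y` collapses the canonical
idempotent of `X ⊗ Y` to `s ∘ ε'` (`proj_ofBiadjunction`). As `ε' ∘ s = 1`, its image `X ⊗_A Y` is
`I_b` (`counitIso`). Two such isomorphisms make an equivalence, and an equivalence can be made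
adjoint by changing its counit only, so its 1-morphisms remain the bimodules `X` and `Y`.

Part (ii). Written in `B`, an adjoint equivalence between `(a, A)` and `(b, I_b)` is an isomorphism
`θ : A ≅ Y ⊗ X` of bimodules together with a splitting `c : X ⊗ Y ⟶ I_b`, `s : I_b ⟶ X ⊗ Y` of the
canonical idempotent, where the triangle identities say that `c` turns `θ` into the actions of `A`
on `X` and `Y` (`FrobeniusAlgebra.Trivialization`, `trivializationOfEquivalence`). Then `c` and `θ`
composed with the unit of `A` are counit and unit of `X ⊣ Y`: the triangle identities are the unit
laws of the modules. Dually, up to `θ`, inserting `s` next to `X` or `Y` is the coaction of `A`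
given by `x ↦ Δ(1) · x` (`s_left`, `s_right`), so the triangle identities of `Y ⊣ X`, with unit `s`
and counit that of `A` composed with `θ⁻¹`, are the counit laws of the comodules. By construction
`c ∘ s = 1` and `θ` preserves the unit and the counit; the formulas for actions and coactions show
that it preserves product and coproduct.

In comments `Y ⊗ X` stands for `X ≫ Y`.
-/

namespace EquivariantCompletion

variable {B : Type u} [Bicategory.{w, v} B]

/-! ### Trivializations of a Frobenius algebra -/

namespace FrobeniusAlgebra

/-- The coproduct is recovered from the copairing `Δ ∘ 1` by multiplying one of its legs. -/
theorem one_comul_mul {a : B} {A : a ⟶ a} (F : FrobeniusAlgebra A) :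
    𝟙 A ⊗≫ (F.one ≫ F.comul) ▷ A ⊗≫ A ◁ F.mul = F.comul := by
  calc _ = 𝟙 _ ⊗≫ F.one ▷ A ⊗≫ (F.comul ▷ A ≫ (α_ _ _ _).hom ≫ A ◁ F.mul) := by bicategory
    _ = 𝟙 _ ⊗≫ (F.one ▷ A ≫ F.mul) ⊗≫ F.comul := by rw [F.frob_right]; bicategory
    _ = _ := by rw [F.one_mul]; bicategory

/-- An adjoint equivalence between `(a, A)` and `(b, I_b)`, spelled out in the ambient bicategory:
actions `src` and `tgt` of `A` on `X` and `Y`, an isomorphism `θ : A ≅ Y ⊗ X` linear over both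
actions, and maps `c`, `s` that split the canonical idempotent of `X ⊗ Y` (the right-hand side of
`c_s`) with image `I_b`. The equations `θ_c` and `c_θ` are the triangle identities. Associativity of
the actions is not recorded. -/
structure Trivialization {a b : B} {A : a ⟶ a} (F : FrobeniusAlgebra A) (X : a ⟶ b)
    (Y : b ⟶ a) where
  src : A ≫ X ⟶ X
  tgt : Y ≫ A ⟶ Y
  θ : A ≅ X ≫ Y
  c : Y ≫ X ⟶ 𝟙 b
  s : 𝟙 b ⟶ Y ≫ X
  src_one : F.one ▷ X ≫ src = (λ_ X).hom
  tgt_one : Y ◁ F.one ≫ tgt = (ρ_ Y).hom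
  θ_src : A ◁ θ.hom ≫ (α_ A X Y).inv ≫ src ▷ Y = F.mul ≫ θ.hom
  θ_tgt : θ.hom ▷ A ≫ (α_ X Y A).hom ≫ X ◁ tgt = F.mul ≫ θ.hom
  s_c : s ≫ c = 𝟙 (𝟙 b)
  c_s : c ≫ s = Y ◁ (λ_ X).inv ≫ Y ◁ (F.one ≫ F.comul) ▷ X ≫ Y ◁ (α_ A A X).hom ≫
    (α_ Y A (A ≫ X)).inv ≫ tgt ▷ (A ≫ X) ≫ Y ◁ src
  θ_c : θ.hom ▷ X ≫ (α_ X Y X).hom ≫ X ◁ c ≫ (ρ_ X).hom = src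
  c_θ : Y ◁ θ.hom ≫ (α_ Y X Y).inv ≫ c ▷ Y ≫ (λ_ Y).hom = tgt

namespace Trivialization

variable {a b : B} {A : a ⟶ a} {F : FrobeniusAlgebra A} {X : a ⟶ b} {Y : b ⟶ a}
  (T : F.Trivialization X Y)

/-- Up to `θ`, inserting `s` next to `Y` is the coaction of `A` on `Y` that splits off a leg of the
copairing `Δ ∘ 1`. -/
theorem s_left : T.s ▷ Y ≫ (α_ Y X Y).hom = (λ_ Y).hom ≫ (ρ_ Y).inv ≫ Y ◁ (F.one ≫ F.comul) ≫
    (α_ Y A A).inv ≫ T.tgt ▷ A ≫ Y ◁ T.θ.hom := by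
  -- Writing the identity of `Y` as the action of the unit of `A` creates, through `c_θ`, a `c` in
  -- front of `s`.
  calc _ = 𝟙 _ ⊗≫ ((ρ_ Y).inv ≫ (ρ_ Y).hom) ⊗≫ T.s ▷ Y ⊗≫ 𝟙 _ := by bicategory
    _ = 𝟙 _ ⊗≫ Y ◁ (F.one ≫ T.θ.hom) ⊗≫ (T.c ≫ T.s) ▷ Y ⊗≫ 𝟙 _ := by
        rw [← T.tgt_one, ← T.c_θ]; bicategory
    _ = 𝟙 _ ⊗≫ Y ◁ (𝟙 a ◁ (F.one ≫ T.θ.hom) ≫ (F.one ≫ F.comul) ▷ (X ≫ Y)) ⊗≫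
          T.tgt ▷ (A ≫ X ≫ Y) ⊗≫ Y ◁ T.src ▷ Y ⊗≫ 𝟙 _ := by
        rw [T.c_s]; bicategory
    _ = 𝟙 _ ⊗≫ Y ◁ (F.one ≫ F.comul) ⊗≫ ((Y ≫ A) ◁ (A ◁ (F.one ≫ T.θ.hom)) ≫
          T.tgt ▷ (A ≫ X ≫ Y)) ⊗≫ Y ◁ T.src ▷ Y ⊗≫ 𝟙 _ := by
        rw [whisker_exchange]; bicategory
    _ = 𝟙 _ ⊗≫ Y ◁ (F.one ≫ F.comul) ⊗≫ T.tgt ▷ (A ≫ 𝟙 a) ⊗≫ Y ◁ (A ◁ F.one ≫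
          (A ◁ T.θ.hom ≫ (α_ A X Y).inv ≫ T.src ▷ Y)) ⊗≫ 𝟙 _ := by
        rw [whisker_exchange]; bicategory
    _ = 𝟙 _ ⊗≫ Y ◁ (F.one ≫ F.comul) ⊗≫ T.tgt ▷ (A ≫ 𝟙 a) ⊗≫ Y ◁ ((A ◁ F.one ≫ F.mul) ≫
          T.θ.hom) ⊗≫ 𝟙 _ := by
        rw [T.θ_src]; bicategory
    _ = _ := by rw [F.mul_one]; bicategory

/-- Up to `θ`, inserting `s` next to `X` is the coaction of `A` on `X` that splits off a leg of the
copairing `Δ ∘ 1`. -/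
theorem s_right : X ◁ T.s ≫ (α_ X Y X).inv = (ρ_ X).hom ≫ (λ_ X).inv ≫ (F.one ≫ F.comul) ▷ X ≫
    (α_ A A X).hom ≫ A ◁ T.src ≫ T.θ.hom ▷ X := by
  calc _ = 𝟙 _ ⊗≫ ((λ_ X).inv ≫ (λ_ X).hom) ⊗≫ X ◁ T.s ⊗≫ 𝟙 _ := by bicategory
    _ = 𝟙 _ ⊗≫ (F.one ≫ T.θ.hom) ▷ X ⊗≫ X ◁ (T.c ≫ T.s) ⊗≫ 𝟙 _ := by
        rw [← T.src_one, ← T.θ_c]; bicategory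
    _ = 𝟙 _ ⊗≫ ((F.one ≫ T.θ.hom) ▷ 𝟙 a ≫ (X ≫ Y) ◁ (F.one ≫ F.comul)) ▷ X ⊗≫
          X ◁ T.tgt ▷ (A ≫ X) ⊗≫ (X ≫ Y) ◁ T.src ⊗≫ 𝟙 _ := by
        rw [T.c_s]; bicategory
    _ = 𝟙 _ ⊗≫ (F.one ≫ F.comul) ▷ X ⊗≫ (F.one ▷ A ≫ (T.θ.hom ▷ A ≫ (α_ X Y A).hom ≫ X ◁ T.tgt))
          ▷ (A ≫ X) ⊗≫ (X ≫ Y) ◁ T.src ⊗≫ 𝟙 _ := by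
        rw [← whisker_exchange]; bicategory
    _ = 𝟙 _ ⊗≫ (F.one ≫ F.comul) ▷ X ⊗≫ ((F.one ▷ A ≫ F.mul) ≫ T.θ.hom)
          ▷ (A ≫ X) ⊗≫ (X ≫ Y) ◁ T.src ⊗≫ 𝟙 _ := by
        rw [T.θ_tgt]; bicategory
    _ = 𝟙 _ ⊗≫ (F.one ≫ F.comul) ▷ X ⊗≫ (T.θ.hom ▷ (A ≫ X) ≫ (X ≫ Y) ◁ T.src) ⊗≫ 𝟙 _ := by
        rw [F.one_mul]; bicategory
    _ = _ := by rw [← whisker_exchange]; bicategory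

/-- The adjunction `X ⊣ Y` of a trivialization. -/
def rightAdj : X ⊣ Y where
  unit := F.one ≫ T.θ.hom
  counit := T.c
  left_triangle := by
    calc _ = F.one ▷ X ≫ (T.θ.hom ▷ X ≫ (α_ X Y X).hom ≫ X ◁ T.c ≫ (ρ_ X).hom) ≫ (ρ_ X).inv := by
          rw [leftZigzag]; bicategory
      _ = _ := by rw [T.θ_c, ← Category.assoc, T.src_one]
  right_triangle := by
    calc _ = Y ◁ F.one ≫ (Y ◁ T.θ.hom ≫ (α_ Y X Y).inv ≫ T.c ▷ Y ≫ (λ_ Y).hom) ≫ (λ_ Y).inv := by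
          rw [rightZigzag]; bicategory
      _ = _ := by rw [T.c_θ, ← Category.assoc, T.tgt_one]

/-- The adjunction `Y ⊣ X` of a trivialization. -/
def leftAdj : Y ⊣ X where
  unit := T.s
  counit := T.θ.inv ≫ F.counit
  left_triangle := by
    calc _ = (T.s ▷ Y ≫ (α_ Y X Y).hom) ≫ Y ◁ (T.θ.inv ≫ F.counit) := by
          rw [leftZigzag]; bicategory
      _ = 𝟙 _ ⊗≫ Y ◁ (F.one ≫ F.comul) ⊗≫ T.tgt ▷ A ⊗≫ Y ◁ ((T.θ.hom ≫ T.θ.inv) ≫ F.counit) := by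
          rw [T.s_left]; bicategory
      _ = 𝟙 _ ⊗≫ Y ◁ (F.one ≫ F.comul) ⊗≫ (T.tgt ▷ A ≫ Y ◁ F.counit) := by
          rw [T.θ.hom_inv_id]; bicategory
      _ = 𝟙 _ ⊗≫ Y ◁ (F.one ≫ (F.comul ≫ A ◁ F.counit)) ⊗≫ T.tgt ▷ 𝟙 a := by
          rw [← whisker_exchange]; bicategory
      _ = 𝟙 _ ⊗≫ (Y ◁ F.one ≫ T.tgt) ⊗≫ 𝟙 _ := by rw [F.comul_counit]; bicategory
      _ = _ := by rw [T.tgt_one]; bicategory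
  right_triangle := by
    calc _ = (X ◁ T.s ≫ (α_ X Y X).inv) ≫ (T.θ.inv ≫ F.counit) ▷ X := by
          rw [rightZigzag]; bicategory
      _ = 𝟙 _ ⊗≫ (F.one ≫ F.comul) ▷ X ⊗≫ A ◁ T.src ⊗≫ ((T.θ.hom ≫ T.θ.inv) ≫ F.counit) ▷ X := by
          rw [T.s_right]; bicategory
      _ = 𝟙 _ ⊗≫ (F.one ≫ F.comul) ▷ X ⊗≫ (A ◁ T.src ≫ F.counit ▷ X) := by
          rw [T.θ.hom_inv_id]; bicategory
      _ = 𝟙 _ ⊗≫ (F.one ≫ (F.comul ≫ F.counit ▷ A)) ▷ X ⊗≫ 𝟙 a ◁ T.src := by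
          rw [whisker_exchange]; bicategory
      _ = 𝟙 _ ⊗≫ (F.one ▷ X ≫ T.src) ⊗≫ 𝟙 _ := by rw [F.counit_comul]; bicategory
      _ = _ := by rw [T.src_one]; bicategory

/-- The isomorphism `θ` preserves the Frobenius algebra structures. -/
def iso : F.Iso (ofBiadjunction T.leftAdj T.rightAdj) where
  iso := T.θ
  map_one := rfl
  map_counit := T.θ.hom_inv_id_assoc _
  map_mul := by
    change _ = (T.θ.hom ▷ A ≫ (X ≫ Y) ◁ T.θ.hom) ≫ (𝟙 _ ⊗≫ X ◁ T.c ▷ Y ⊗≫ 𝟙 _)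
    calc _ = 𝟙 _ ⊗≫ A ◁ T.θ.hom ⊗≫
          (T.θ.hom ▷ X ≫ (α_ X Y X).hom ≫ X ◁ T.c ≫ (ρ_ X).hom) ▷ Y := by
          rw [← T.θ_src, T.θ_c]; bicategory
      _ = (A ◁ T.θ.hom ≫ T.θ.hom ▷ (X ≫ Y)) ⊗≫ X ◁ T.c ▷ Y ⊗≫ 𝟙 _ := by bicategory
      _ = _ := by rw [whisker_exchange]; bicategory
  map_comul := by
    change _ = T.θ.hom ≫ (𝟙 _ ⊗≫ X ◁ T.s ▷ Y ⊗≫ 𝟙 _)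
    symm
    calc _ = T.θ.hom ⊗≫ (X ◁ T.s ≫ (α_ X Y X).inv) ▷ Y ⊗≫ 𝟙 _ := by bicategory
      _ = 𝟙 _ ⊗≫ (𝟙 a ◁ T.θ.hom ≫ (F.one ≫ F.comul) ▷ (X ≫ Y)) ⊗≫ A ◁ T.src ▷ Y ⊗≫
            T.θ.hom ▷ (X ≫ Y) ⊗≫ 𝟙 _ := by
          rw [T.s_right]; bicategory
      _ = 𝟙 _ ⊗≫ (F.one ≫ F.comul) ▷ A ⊗≫
            A ◁ (A ◁ T.θ.hom ≫ (α_ A X Y).inv ≫ T.src ▷ Y) ⊗≫ T.θ.hom ▷ (X ≫ Y) ⊗≫ 𝟙 _ := by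
          rw [whisker_exchange]; bicategory
      _ = (𝟙 A ⊗≫ (F.one ≫ F.comul) ▷ A ⊗≫ A ◁ F.mul) ≫ (A ◁ T.θ.hom ≫ T.θ.hom ▷ (X ≫ Y)) := by
          rw [T.θ_src]; bicategory
      _ = _ := by rw [F.one_comul_mul, whisker_exchange]

end Trivialization
end FrobeniusAlgebra

/-! ### Tensor products over a trivial algebra -/

namespace Bimodule

/-- The canonical idempotent with explicit associators. Unlike the implicit ones of `⊗≫`, they stay
the same when the middle algebra is specialized to a composite or an identity 1-morphism. -/
theorem proj_eq {P Q R : EqCompletion B} (X : Bimodule P Q) (Y : Bimodule Q R) :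
    proj X Y = X.obj ◁ (λ_ Y.obj).inv ≫ X.obj ◁ (Q.frob.one ≫ Q.frob.comul) ▷ Y.obj ≫
      X.obj ◁ (α_ Q.alg Q.alg Y.obj).hom ≫ (α_ X.obj Q.alg (Q.alg ≫ Y.obj)).inv ≫
        X.tgt ▷ (Q.alg ≫ Y.obj) ≫ X.obj ◁ Y.src := by
  rw [proj]; bicategory

variable {P : EqCompletion B} {b : B}

theorem src_ofBase (Y : Bimodule (EqCompletion.ofBase b) P) : Y.src = (λ_ Y.obj).hom := by
  rw [← Y.src_one]
  change _ = 𝟙 (𝟙 _) ▷ Y.obj ≫ Y.src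
  rw [id_whiskerRight]
  exact (Category.id_comp Y.src).symm

theorem tgt_ofBase (X : Bimodule P (EqCompletion.ofBase b)) : X.tgt = (ρ_ X.obj).hom := by
  rw [← X.tgt_one]
  change _ = X.obj ◁ 𝟙 (𝟙 _) ≫ X.tgt
  rw [whiskerLeft_id]
  exact (Category.id_comp X.tgt).symm

theorem proj_ofBase {R : EqCompletion B} (X : Bimodule P (EqCompletion.ofBase b))
    (Y : Bimodule (EqCompletion.ofBase b) R) : proj X Y = 𝟙 _ := by
  have key {p q r : B} (U : p ⟶ q) (V : q ⟶ r) :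
      U ◁ (λ_ V).inv ≫ U ◁ (𝟙 (𝟙 q) ≫ (λ_ (𝟙 q)).inv) ▷ V ≫ U ◁ (α_ (𝟙 q) (𝟙 q) V).hom ≫
        (α_ U (𝟙 q) (𝟙 q ≫ V)).inv ≫ (ρ_ U).hom ▷ (𝟙 q ≫ V) ≫ U ◁ (λ_ V).hom = 𝟙 _ := by
    bicategory
  rw [proj_eq, tgt_ofBase, src_ofBase]
  exact key X.obj Y.obj

/-- Over trivial algebras, every 2-morphism is a bimodule map. -/
def isoOfBase {a : B} {U V : Bimodule (EqCompletion.ofBase a) (EqCompletion.ofBase b)}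
    (i : U.obj ≅ V.obj) : U ≅ V :=
  isoOf i
    (by rw [src_ofBase, src_ofBase]; exact leftUnitor_naturality i.hom)
    (by rw [tgt_ofBase, tgt_ofBase]; exact rightUnitor_naturality i.hom)

variable [∀ a b : B, IsIdempotentComplete (a ⟶ b)]

/-- Over a trivial algebra, the relative tensor product is the composite in `B`. -/
noncomputable def πIso {R : EqCompletion B} (X : Bimodule P (EqCompletion.ofBase b))
    (Y : Bimodule (EqCompletion.ofBase b) R) : X.obj ≫ Y.obj ≅ (tensor X Y).obj where
  hom := π X Y
  inv := ι X Y
  hom_inv_id := by rw [π_ι, proj_ofBase]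
  inv_hom_id := ι_π X Y

theorem ι_src {R : EqCompletion B} (X : Bimodule P (EqCompletion.ofBase b))
    (Y : Bimodule (EqCompletion.ofBase b) R) :
    P.alg ◁ ι X Y ≫ (α_ _ _ _).inv ≫ X.src ▷ Y.obj = (tensor X Y).src ≫ ι X Y := by
  rw [← cancel_mono (πIso X Y).hom]
  calc _ = P.alg ◁ ι X Y ≫ ((α_ _ _ _).inv ≫ X.src ▷ Y.obj ≫ π X Y) := by
        simp only [Category.assoc]; rfl
    _ = P.alg ◁ (ι X Y ≫ π X Y) ≫ (tensor X Y).src := by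
        rw [← π_src, whiskerLeft_comp, Category.assoc]
    _ = (tensor X Y).src ≫ (ι X Y ≫ π X Y) := by rw [ι_π]; simp
    _ = _ := (Category.assoc _ _ _).symm

theorem ι_tgt {R : EqCompletion B} (X : Bimodule P (EqCompletion.ofBase b))
    (Y : Bimodule (EqCompletion.ofBase b) R) :
    ι X Y ▷ R.alg ≫ (α_ _ _ _).hom ≫ X.obj ◁ Y.tgt = (tensor X Y).tgt ≫ ι X Y := by
  rw [← cancel_mono (πIso X Y).hom]
  calc _ = ι X Y ▷ R.alg ≫ ((α_ _ _ _).hom ≫ X.obj ◁ Y.tgt ≫ π X Y) := by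
        simp only [Category.assoc]; rfl
    _ = (ι X Y ≫ π X Y) ▷ R.alg ≫ (tensor X Y).tgt := by
        rw [← π_tgt, comp_whiskerRight, Category.assoc]
    _ = (tensor X Y).tgt ≫ (ι X Y ≫ π X Y) := by rw [ι_π]; simp
    _ = _ := (Category.assoc _ _ _).symm

/-- A splitting of the canonical idempotent is isomorphic to the tensor product. -/
noncomputable def tensorObjIso {P Q R : EqCompletion B} {X : Bimodule P Q} {Y : Bimodule Q R}
    {Z : P.base ⟶ R.base} {φ : X.obj ≫ Y.obj ⟶ Z} (hφ : Balanced X Y φ) (σ : Z ⟶ X.obj ≫ Y.obj)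
    (hσ : σ ≫ φ = 𝟙 Z) (h : proj X Y = φ ≫ σ) : (tensor X Y).obj ≅ Z where
  hom := ι X Y ≫ φ
  inv := σ ≫ π X Y
  hom_inv_id := by
    rw [Category.assoc, ← Category.assoc φ, ← h, ← π_ι, Category.assoc, ι_π, Category.comp_id, ι_π]
  inv_hom_id := by rw [Category.assoc, π_desc X Y hφ, hσ]

end Bimodule

open Bimodule

/-! ### The equivalence given by a biadjunction -/

section OfBiadjunction

variable {a b : B} {X : a ⟶ b} {Y : b ⟶ a}

/-- The canonical idempotent of `X ⊗ Y` over the algebra `Y ⊗ X`, whose coproduct inserts `s`,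
factors through the counit of `X ⊣ Y`. -/
theorem counit_comp_eq_idempotent (s : 𝟙 b ⟶ Y ≫ X) (r : X ⊣ Y) :
    Y ◁ (λ_ X).inv ≫ Y ◁ (r.unit ≫ (𝟙 (X ≫ Y) ⊗≫ X ◁ s ▷ Y ⊗≫ 𝟙 ((X ≫ Y) ≫ X ≫ Y))) ▷ X ≫
      Y ◁ (α_ (X ≫ Y) (X ≫ Y) X).hom ≫ (α_ Y (X ≫ Y) ((X ≫ Y) ≫ X)).inv ≫
        ((α_ Y X Y).inv ≫ r.counit ▷ Y ≫ (λ_ Y).hom) ▷ ((X ≫ Y) ≫ X) ≫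
          Y ◁ ((α_ X Y X).hom ≫ X ◁ r.counit ≫ (ρ_ X).hom) = r.counit ≫ s := by
  calc _ = 𝟙 _ ⊗≫ Y ◁ r.unit ▷ X ⊗≫ ((Y ≫ X) ◁ s ≫ r.counit ▷ (Y ≫ X)) ▷ (Y ≫ X) ⊗≫
        (Y ≫ X) ◁ r.counit ⊗≫ 𝟙 _ := by bicategory
    _ = 𝟙 _ ⊗≫ Y ◁ r.unit ▷ X ⊗≫ r.counit ▷ (Y ≫ X) ⊗≫ (s ▷ (Y ≫ X) ≫
        (Y ≫ X) ◁ r.counit) ⊗≫ 𝟙 _ := by rw [whisker_exchange]; bicategory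
    _ = 𝟙 _ ⊗≫ rightZigzag r.unit r.counit ▷ X ⊗≫ r.counit ⊗≫ s ⊗≫ 𝟙 _ := by
        rw [← whisker_exchange, rightZigzag]; bicategory
    _ = _ := by rw [r.right_triangle]; bicategory

variable (l : Y ⊣ X) (r : X ⊣ Y) [IsIso (l.unit ≫ r.counit)]

theorem balanced_counit : Balanced (ofLeft l r) (ofRight l r) r.counit := by
  change ((α_ Y X Y).inv ≫ r.counit ▷ Y ≫ (λ_ Y).hom) ▷ X ≫ r.counit =
    (α_ Y (X ≫ Y) X).hom ≫ Y ◁ ((α_ X Y X).hom ≫ X ◁ r.counit ≫ (ρ_ X).hom) ≫ r.counit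
  calc _ = 𝟙 _ ⊗≫ (r.counit ▷ (Y ≫ X) ≫ 𝟙 b ◁ r.counit) ⊗≫ 𝟙 _ := by bicategory
    _ = _ := by rw [← whisker_exchange]; bicategory

theorem proj_ofBiadjunction :
    proj (ofLeft l r) (ofRight l r) = r.counit ≫ (twist l (bubbleAut l r)).unit := by
  rw [proj_eq]
  exact counit_comp_eq_idempotent _ r

variable [∀ a b : B, IsIdempotentComplete (a ⟶ b)]

/-- The algebra `Y ⊗ X`, as a bimodule over itself, is the composite of `X` and `Y`. -/
noncomputable def unitIso :
    Bimodule.unit (EqCompletion.ofBiadjunction l r) ≅ tensor (ofRight l r) (ofLeft l r) :=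
  isoOf (πIso (ofRight l r) (ofLeft l r))
    (by
      refine (π_src (ofRight l r) (ofLeft l r)).trans ?_
      rw [← Category.assoc]
      refine congrArg (· ≫ π (ofRight l r) (ofLeft l r)) ?_
      change (α_ (X ≫ Y) X Y).inv ≫ ((α_ X Y X).hom ≫ X ◁ r.counit ≫ (ρ_ X).hom) ▷ Y =
        𝟙 _ ⊗≫ X ◁ r.counit ▷ Y ⊗≫ 𝟙 _
      bicategory)
    (by
      refine (π_tgt (ofRight l r) (ofLeft l r)).trans ?_
      rw [← Category.assoc]
      refine congrArg (· ≫ π (ofRight l r) (ofLeft l r)) ?_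
      change (α_ X Y (X ≫ Y)).hom ≫ X ◁ ((α_ Y X Y).inv ≫ r.counit ▷ Y ≫ (λ_ Y).hom) =
        𝟙 _ ⊗≫ X ◁ r.counit ▷ Y ⊗≫ 𝟙 _
      bicategory)

/-- The composite of `Y` and `X` over the algebra `Y ⊗ X` is trivial. -/
noncomputable def counitIso :
    tensor (ofLeft l r) (ofRight l r) ≅ Bimodule.unit (EqCompletion.ofBase b) :=
  isoOfBase (tensorObjIso (balanced_counit l r) (twist l (bubbleAut l r)).unit (bubble_twist l r)
    (proj_ofBiadjunction l r))

/-- The adjoint equivalence given by `X` and `Y`. Its counit is in general not `counitIso`, but the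
correction of it that satisfies the triangle identities. -/
noncomputable def equivalenceOfBiadjunction :
    Bicategory.Equivalence (EqCompletion.ofBiadjunction l r) (EqCompletion.ofBase b) :=
  .mkOfAdjointifyCounit (f := ofRight l r) (g := ofLeft l r) (unitIso l r) (counitIso l r)

end OfBiadjunction

/-! ### The trivialization given by an adjoint equivalence -/

section OfEquivalence

variable [∀ a b : B, IsIdempotentComplete (a ⟶ b)]

/-- The left triangle identity of an adjunction in `EqCompletion B`, as a formula in `B` for the
right action on `X`. -/
theorem left_triangle_src {P Q : EqCompletion B} {X : Bimodule P Q} {Y : Bimodule Q P}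
    (η : unit P ⟶ tensor X Y) (κ : tensor Y X ⟶ unit Q)
    (h : whiskerR η X ≫ (assoc X Y X).hom ≫ whiskerL X κ = (leftUnit X).hom ≫ (rightUnit X).inv)
    (θ : P.alg ⟶ X.obj ≫ Y.obj) (hθ : θ ≫ π X Y = η.hom) :
    θ ▷ X.obj ≫ (α_ _ _ _).hom ≫ X.obj ◁ (π Y X ≫ κ.hom) ≫ X.tgt = X.src := by
  have h' : whiskerR η X ≫ (assoc X Y X).hom ≫ whiskerL X κ ≫ (rightUnit X).hom =
      (leftUnit X).hom := by
    rw [← cancel_mono (rightUnit X).inv]; simpa using h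
  have h₁ : π (unit P) X ≫ (whiskerR η X).hom = θ ▷ X.obj ≫ π X Y ▷ X.obj ≫ π (tensor X Y) X := by
    rw [π_whiskerR, ← hθ, comp_whiskerRight, Category.assoc]
  calc _ = θ ▷ X.obj ≫ ((α_ _ _ _).hom ≫ X.obj ◁ π Y X ≫ π X (tensor Y X)) ≫
        (whiskerL X κ).hom ≫ (rightUnit X).hom.hom := by
        simp only [Category.assoc]
        rw [← Category.assoc (π X (tensor Y X)), π_whiskerL, Category.assoc, π_rightUnit,
          whiskerLeft_comp, Category.assoc]
    _ = (π (unit P) X ≫ (whiskerR η X).hom) ≫ (assoc X Y X).hom.hom ≫ (whiskerL X κ).hom ≫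
        (rightUnit X).hom.hom := by
        rw [h₁, ← π_assoc]; simp only [Category.assoc]
    _ = π (unit P) X ≫
        Hom.hom (whiskerR η X ≫ (assoc X Y X).hom ≫ whiskerL X κ ≫ (rightUnit X).hom) := by
        simp only [comp_hom, Category.assoc]
    _ = _ := by rw [h', π_leftUnit]

/-- The right triangle identity of an adjunction in `EqCompletion B`, as a formula in `B` for the
left action on `Y`. -/
theorem right_triangle_tgt {P Q : EqCompletion B} {X : Bimodule P Q} {Y : Bimodule Q P}
    (η : unit P ⟶ tensor X Y) (κ : tensor Y X ⟶ unit Q)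
    (h : whiskerL Y η ≫ (assoc Y X Y).inv ≫ whiskerR κ Y = (rightUnit Y).hom ≫ (leftUnit Y).inv)
    (θ : P.alg ⟶ X.obj ≫ Y.obj) (hθ : θ ≫ π X Y = η.hom) :
    Y.obj ◁ θ ≫ (α_ _ _ _).inv ≫ (π Y X ≫ κ.hom) ▷ Y.obj ≫ Y.src = Y.tgt := by
  have h' : whiskerL Y η ≫ (assoc Y X Y).inv ≫ whiskerR κ Y ≫ (leftUnit Y).hom =
      (rightUnit Y).hom := by
    rw [← cancel_mono (leftUnit Y).inv]; simpa using h
  have h₁ : π Y (unit P) ≫ (whiskerL Y η).hom = Y.obj ◁ θ ≫ Y.obj ◁ π X Y ≫ π Y (tensor X Y) := by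
    rw [π_whiskerL, ← hθ, whiskerLeft_comp, Category.assoc]
  have h₂ : Y.obj ◁ π X Y ≫ π Y (tensor X Y) ≫ (assoc Y X Y).inv.hom =
      (α_ _ _ _).inv ≫ π Y X ▷ Y.obj ≫ π (tensor Y X) Y := ππ_assocInv Y X Y
  calc _ = Y.obj ◁ θ ≫ ((α_ _ _ _).inv ≫ π Y X ▷ Y.obj ≫ π (tensor Y X) Y) ≫
        (whiskerR κ Y).hom ≫ (leftUnit Y).hom.hom := by
        simp only [Category.assoc]
        rw [← Category.assoc (π (tensor Y X) Y), π_whiskerR, Category.assoc, π_leftUnit,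
          comp_whiskerRight, Category.assoc]
    _ = (π Y (unit P) ≫ (whiskerL Y η).hom) ≫ (assoc Y X Y).inv.hom ≫ (whiskerR κ Y).hom ≫
        (leftUnit Y).hom.hom := by
        rw [h₁, ← h₂]; simp only [Category.assoc]
    _ = π Y (unit P) ≫
        Hom.hom (whiskerL Y η ≫ (assoc Y X Y).inv ≫ whiskerR κ Y ≫ (leftUnit Y).hom) := by
        simp only [comp_hom, Category.assoc]
    _ = _ := by rw [h', π_rightUnit]

/-- The 2-isomorphism in `B` underlying an isomorphism of bimodules. -/
def objIso {P Q : EqCompletion B} {X Y : Bimodule P Q} (i : X ≅ Y) : X.obj ≅ Y.obj where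
  hom := i.hom.hom
  inv := i.inv.hom
  hom_inv_id := by rw [← comp_hom, i.hom_inv_id, id_hom]
  inv_hom_id := by rw [← comp_hom, i.inv_hom_id, id_hom]

section

variable {P Q R : EqCompletion B} {X : Bimodule P Q} {Y : Bimodule Q R} {Z : Bimodule P R}
  (κ : tensor X Y ≅ Z)

theorem inv_ι_π_hom : (κ.inv.hom ≫ ι X Y) ≫ π X Y ≫ κ.hom.hom = 𝟙 Z.obj := by
  rw [Category.assoc, ← Category.assoc (ι X Y), ι_π, Category.id_comp]
  exact (objIso κ).inv_hom_id

theorem π_hom_inv_ι : (π X Y ≫ κ.hom.hom) ≫ κ.inv.hom ≫ ι X Y = proj X Y := by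
  have h : κ.hom.hom ≫ κ.inv.hom = 𝟙 _ := (objIso κ).hom_inv_id
  rw [Category.assoc, ← Category.assoc κ.hom.hom, h, Category.id_comp, π_ι]

end

variable {P : EqCompletion B} {b : B}

/-- The trivialization of the Frobenius algebra of `P` given by unit and counit of an adjoint
equivalence with `(b, I_b)`. -/
noncomputable def trivialization {X : Bimodule P (EqCompletion.ofBase b)}
    {Y : Bimodule (EqCompletion.ofBase b) P} (η : unit P ≅ tensor X Y)
    (κ : tensor Y X ≅ unit (EqCompletion.ofBase b))
    (hl : whiskerR η.hom X ≫ (assoc X Y X).hom ≫ whiskerL X κ.hom =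
      (leftUnit X).hom ≫ (rightUnit X).inv)
    (hr : whiskerL Y η.hom ≫ (assoc Y X Y).inv ≫ whiskerR κ.hom Y =
      (rightUnit Y).hom ≫ (leftUnit Y).inv) :
    P.frob.Trivialization X.obj Y.obj where
  src := X.src
  tgt := Y.tgt
  θ := objIso η ≪≫ (πIso X Y).symm
  c := π Y X ≫ κ.hom.hom
  s := κ.inv.hom ≫ ι Y X
  src_one := X.src_one
  tgt_one := Y.tgt_one
  θ_src := by
    change P.alg ◁ (η.hom.hom ≫ ι X Y) ≫ _ = P.frob.mul ≫ η.hom.hom ≫ ι X Y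
    rw [whiskerLeft_comp, Category.assoc, ι_src, ← Category.assoc, η.hom.src_comm, Category.assoc]
  θ_tgt := by
    change (η.hom.hom ≫ ι X Y) ▷ P.alg ≫ _ = P.frob.mul ≫ η.hom.hom ≫ ι X Y
    rw [comp_whiskerRight, Category.assoc, ι_tgt, ← Category.assoc, η.hom.tgt_comm, Category.assoc]
  s_c := inv_ι_π_hom κ
  c_s := (π_hom_inv_ι κ).trans (proj_eq Y X)
  θ_c := by
    have h := left_triangle_src η.hom κ.hom hl (η.hom.hom ≫ ι X Y) (by
      rw [Category.assoc, ι_π, Category.comp_id])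
    rw [tgt_ofBase] at h
    exact h
  c_θ := by
    have h := right_triangle_tgt η.hom κ.hom hr (η.hom.hom ≫ ι X Y) (by
      rw [Category.assoc, ι_π, Category.comp_id])
    rw [src_ofBase] at h
    exact h

/-- `trivialization` for a bundled adjoint equivalence. -/
noncomputable def trivializationOfEquivalence
    (e : Bicategory.Equivalence P (EqCompletion.ofBase b)) :
    P.frob.Trivialization (Bimodule.obj e.hom) (Bimodule.obj e.inv) :=
  trivialization (X := e.hom) (Y := e.inv) e.unit e.counit
    (by
      have h : e.unit.hom ▷ e.hom ≫ (α_ _ _ _).hom ≫ e.hom ◁ e.counit.hom =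
          (λ_ e.hom).hom ≫ (ρ_ e.hom).inv := by
        simpa [leftZigzag, bicategoricalComp] using e.left_triangle_hom
      exact h)
    (by
      have h : e.inv ◁ e.unit.hom ≫ (α_ _ _ _).inv ≫ e.counit.hom ▷ e.inv =
          (ρ_ e.inv).hom ≫ (λ_ e.inv).inv := by
        simpa [rightZigzag, bicategoricalComp] using e.right_triangle_hom
      exact h)

end OfEquivalence

end EquivariantCompletion

open EquivariantCompletion
theorem proposition4p4 {B : Type u} [Bicategory.{w, v} B]
    [∀ a b : B, IsIdempotentComplete (a ⟶ b)] {a b : B} (X : a ⟶ b) (Y : b ⟶ a) :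
    (∀ (l : Y ⊣ X) (r : X ⊣ Y) [IsIso (l.unit ≫ r.counit)],
      ∃ e : Bicategory.Equivalence (EqCompletion.ofBiadjunction l r)
          (EqCompletion.ofBase b),
        e.hom = Bimodule.ofRight l r ∧
        e.inv = Bimodule.ofLeft l r) ∧
    (∀ (A : a ⟶ a) (F : FrobeniusAlgebra A) (hF : F.IsSeparable)
      (e : Bicategory.Equivalence (EqCompletion.mk a A F hF)
        (EqCompletion.ofBase b)),
      e.hom.obj = X →
      e.inv.obj = Y →
      ∃ (l : Y ⊣ X) (r : X ⊣ Y), l.unit ≫ r.counit = 𝟙 (𝟙 b) ∧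
        Nonempty (F.Iso (FrobeniusAlgebra.ofBiadjunction l r))) := by
  refine ⟨fun l r _ => ⟨equivalenceOfBiadjunction l r, rfl, rfl⟩, ?_⟩
  rintro A F hF e rfl rfl
  let T := trivializationOfEquivalence e
  exact ⟨T.leftAdj, T.rightAdj, T.s_c, ⟨T.iso⟩⟩
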